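/- Let $k$ be a finite field, $R$ a field of characteristic zero, and $\mathfrak U\le k^\times$ a subgroup. Let $\mathcal C$ be one of the following two categories. (i) $\mathrm{SI}(k)$: objects are finite-dimensional symplectic $k$-vector spaces, morphisms are injective linear maps preserving the symplectic forms; the degree of an object is half its dimension. (ii) $\mathrm{VIC}^{\mathfrak U}(k)$: objects are finite-dimensional $k$-vector spaces $V$, each nonzero one being equipped with a $\mathfrak U$-orientation, i.e. a generator of $\bigwedge^{\dim V}V$ up to multiplication by $\mathfrak U$. A morphism $V\to W$ is a pair $(T,C)$ with $T:V\to W$ linear and injective and $C$ a direct complement of $T(V)$ in $W$, where, if $\dim V=\dim W$, the isomorphism $T$ is required to respect the $\mathfrak U$-orientations (when $\dim V<\dim W$ there is no further condition). Composition is $(T,C)\circ(S,D)=(T\circ S,\,C\oplus T(D))$. The degree of an object is its dimension. A $\mathcal C$-module over $R$ is a functor from $\mathcal C$ to $R$-modules. Let $\mathcal B\subset\mathcal C$ be the subcategory of all objects and all isomorphisms, and let $M$ be the left adjoint of the restriction functor from $\mathcal C$-modules to $\mathcal B$-modules. A $\mathcal B$-module is supported in degrees $\le d$ if it vanishes on all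 objects of degree $>d$. A $\mathcal C$-module $A$ is generated in degree $\le d$ if there is a surjection $M(W)\twoheadrightarrow A$ for some $\mathcal B$-module $W$ supported in degrees $\le d$; it is related in degree $\le r$ if there is such a surjection, for some $d$, whose kernel is generated in degree $\le r$. It is presented in finite degree if it is generated in degree $\le d$ and related in degree $\le r$ for some integers $d,r\ge 0$. Then the full subcategory of the category of $\mathcal C$-modules over $R$ on the modules presented in finite degree is closed under kernels and cokernels, and it is an abelian category. -/

import Mathlib

open CategoryTheory CategoryTheory.Limits

universe u v

/-! ### The category `SI(k)` of symplectic vector spaces and isometric embeddings -/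

/-- A finite-dimensional symplectic vector space over `k`. -/
structure SI (k : Type u) [Field k] : Type (u + 1) where
  carrier : Type u
  [addCommGroup : AddCommGroup carrier]
  [module : Module k carrier]
  [finite : FiniteDimensional k carrier]
  form : LinearMap.BilinForm k carrier
  isAlt : form.IsAlt
  nondegenerate : form.Nondegenerate

namespace SI

variable {k : Type u} [Field k]

instance : CoeSort (SI k) (Type u) := ⟨SI.carrier⟩

attribute [instance] SI.addCommGroup SI.module SI.finite

/-- A symplectic embedding: an injective linear map preserving the symplectic forms. -/
@[ext]
structure Hom (V W : SI k) : Type u where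
  toLin : V →ₗ[k] W
  injective : Function.Injective toLin
  isometry : ∀ x y : V, W.form (toLin x) (toLin y) = V.form x y

instance : Category.{u} (SI k) where
  Hom V W := Hom V W
  id V := ⟨LinearMap.id, fun _ _ h => h, fun _ _ => rfl⟩
  comp f g := ⟨g.toLin ∘ₗ f.toLin, g.injective.comp f.injective,
    fun x y => (g.isometry _ _).trans (f.isometry x y)⟩

/-- The degree of a symplectic space is half of its (always even) dimension. -/
noncomputable def degree (V : SI k) : ℕ := Module.finrank k V / 2

end SI

/-! ### The category `VIC^U(k)` of `U`-oriented vector spaces and complemented injections -/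

/-- A `U`-orientation of a finite-dimensional vector space `V`: a generator of the top exterior
power of `V` (a line inside the exterior algebra of `V`), up to multiplication by `U`; that is, a
`U`-orbit of generators. -/
@[ext]
structure UOrientation (k : Type u) [Field k] (U : Subgroup kˣ) (V : Type u) [AddCommGroup V]
    [Module k V] : Type u where
  orbit : Set (ExteriorAlgebra k V)
  exists_generator : ∃ ω : ExteriorAlgebra k V,
    Submodule.span k {ω} = ⋀[k]^(Module.finrank k V) V ∧
      orbit = {x | ∃ c ∈ U, x = (c : k) • ω}

/-- A finite-dimensional vector space over `k` which, if it is nonzero, is equipped with a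
`U`-orientation. -/
structure VICU (k : Type u) [Field k] (U : Subgroup kˣ) : Type (u + 1) where
  carrier : Type u
  [addCommGroup : AddCommGroup carrier]
  [module : Module k carrier]
  [finite : FiniteDimensional k carrier]
  orientation : Module.finrank k carrier ≠ 0 → UOrientation k U carrier

namespace VICU

variable {k : Type u} [Field k] {U : Subgroup kˣ}

instance : CoeSort (VICU k U) (Type u) := ⟨VICU.carrier⟩

attribute [instance] VICU.addCommGroup VICU.module VICU.finite

/-- A morphism `V → W`: an injective linear map `T : V → W` together with a complement `C` of
`T(V)` in `W`. If `V` and `W` have the same dimension (so that `C = 0` and `T` is an isomorphism),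
then `T` must respect the `U`-orientations. If `V` has smaller dimension, there is no condition:
the `U`-orientation that `C` receives is determined by those of `V` and `W`, so it is no
additional datum. -/
@[ext]
structure Hom (V W : VICU k U) : Type u where
  toLin : V →ₗ[k] W
  compl : Submodule k W
  injective : Function.Injective toLin
  isCompl : IsCompl (LinearMap.range toLin) compl
  map_orientation : Module.finrank k V = Module.finrank k W →
    ∀ (hV : Module.finrank k V ≠ 0) (hW : Module.finrank k W ≠ 0),
      ExteriorAlgebra.map toLin '' (V.orientation hV).orbit = (W.orientation hW).orbit

/-- The identity morphism `(id, 0)`. -/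
def Hom.id (V : VICU k U) : Hom V V where
  toLin := LinearMap.id
  compl := ⊥
  injective := fun _ _ h => h
  isCompl := by rw [LinearMap.range_id]; exact isCompl_top_bot
  map_orientation := by
    intro _ _ _
    simp [ExteriorAlgebra.map_id]

/-- Composition `(T, C) ∘ (S, D) = (T ∘ S, C ⊕ T(D))`. -/
def Hom.comp {V W X : VICU k U} (f : Hom V W) (g : Hom W X) : Hom V X where
  toLin := g.toLin ∘ₗ f.toLin
  compl := g.compl ⊔ f.compl.map g.toLin
  injective := g.injective.comp f.injective
  isCompl := by
    have hr : LinearMap.range (g.toLin ∘ₗ f.toLin) = (LinearMap.range f.toLin).map g.toLin :=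
      LinearMap.range_comp _ _
    have hd : Disjoint ((LinearMap.range f.toLin).map g.toLin) (f.compl.map g.toLin) :=
      (Submodule.disjoint_map g.injective f.isCompl.disjoint)
    have hs : (LinearMap.range f.toLin).map g.toLin ⊔ f.compl.map g.toLin
        = LinearMap.range g.toLin := by
      rw [← Submodule.map_sup, f.isCompl.sup_eq_top, Submodule.map_top]
    rw [hr, sup_comm]
    refine ⟨?_, ?_⟩
    · refine Disjoint.disjoint_sup_right_of_disjoint_sup_left hd ?_
      rw [hs]
      exact g.isCompl.disjoint
    · rw [codisjoint_iff, ← sup_assoc, hs, g.isCompl.sup_eq_top]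
  map_orientation := by
    intro h hV hX
    have h1 := LinearMap.finrank_le_finrank_of_injective f.injective
    have h2 := LinearMap.finrank_le_finrank_of_injective g.injective
    have hW : Module.finrank k W ≠ 0 := by omega
    rw [← g.map_orientation (by omega) hW hX, ← f.map_orientation (by omega) hV hW,
      Set.image_image]
    refine Set.image_congr fun x _ => ?_
    rw [← ExteriorAlgebra.map_comp_map]
    rfl

instance : Category.{u} (VICU k U) where
  Hom V W := Hom V W
  id V := Hom.id V
  comp f g := Hom.comp f g
  id_comp f := by
    apply Hom.ext
    · rfl
    · simp [Hom.comp, Hom.id]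
  comp_id f := by
    apply Hom.ext
    · rfl
    · simp [Hom.comp, Hom.id]
  assoc f g h := by
    apply Hom.ext
    · rfl
    · simp [Hom.comp, Submodule.map_sup, Submodule.map_comp, sup_assoc]

/-- The degree of an object of `VIC^U(k)` is its dimension. -/
noncomputable def degree (V : VICU k U) : ℕ := Module.finrank k V

end VICU

/-! ### Modules over a category, induced modules, and presentation degree -/

namespace CatModule

variable {C : Type (u + 1)} [Category.{u} C] {R : Type v} [CommRing R]

/-- A module over the groupoid `Core C` of isomorphisms of `C` is supported in degrees `≤ d`. -/
def SupportedLE (deg : C → ℕ) (W : Core C ⥤ ModuleCat.{max u v} R) (d : ℕ) : Prop :=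
  ∀ X : Core C, d < deg X.of → IsZero (W.obj X)

/-- `η` exhibits the `C`-module `M` as the induced module of the `Core C`-module `W`, i.e. as the
value at `W` of the left adjoint of the restriction functor from `C`-modules to `Core C`-modules:
every morphism from `W` to the restriction of a `C`-module `N` factors through `η` for a unique
morphism `M ⟶ N`. -/
abbrev IsInduced (W : Core C ⥤ ModuleCat.{max u v} R) (M : C ⥤ ModuleCat.{max u v} R)
    (η : W ⟶ Core.inclusion C ⋙ M) : Prop :=
  M.IsLeftKanExtension η

/-- The `C`-module `A` is generated in degree `≤ d`: it is a quotient of the induced module of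
some `Core C`-module supported in degrees `≤ d`. -/
def GeneratedLE (deg : C → ℕ) (A : C ⥤ ModuleCat.{max u v} R) (d : ℕ) : Prop :=
  ∃ (W : Core C ⥤ ModuleCat.{max u v} R) (M : C ⥤ ModuleCat.{max u v} R)
    (η : W ⟶ Core.inclusion C ⋙ M) (p : M ⟶ A),
    SupportedLE deg W d ∧ IsInduced W M η ∧ Epi p

/-- The `C`-module `A` is related in degree `≤ r`: it is a quotient of the induced module of some
`Core C`-module supported in bounded degrees, with kernel generated in degree `≤ r`. -/
def RelatedLE (deg : C → ℕ) (A : C ⥤ ModuleCat.{max u v} R) (r : ℕ) : Prop :=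
  ∃ (d : ℕ) (W : Core C ⥤ ModuleCat.{max u v} R) (M : C ⥤ ModuleCat.{max u v} R)
    (η : W ⟶ Core.inclusion C ⋙ M) (p : M ⟶ A),
    SupportedLE deg W d ∧ IsInduced W M η ∧ Epi p ∧ GeneratedLE deg (kernel p) r

/-- The `C`-module `A` has presentation degree `≤ n`. -/
def PresentedLE (deg : C → ℕ) (A : C ⥤ ModuleCat.{max u v} R) (n : ℕ) : Prop :=
  ∃ d r : ℕ, GeneratedLE deg A d ∧ RelatedLE deg A r ∧ max d r ≤ n

/-- The property of a `C`-module over `R` of being presented in finite degree. -/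
def presentedInFiniteDegree (R : Type v) [CommRing R] (deg : C → ℕ) :
    ObjectProperty (C ⥤ ModuleCat.{max u v} R) :=
  fun A => ∃ n : ℕ, PresentedLE deg A n

end CatModule

/-! Bounds on generators and relations do not visibly pass to kernels, so presentation in finite
degree is traded for a condition that does. For `f : Z ⟶ V` let `G_f` be the finite group of
automorphisms of `V` fixing `f`. In characteristic zero, averaging over `G_f` identifies invariants
with coinvariants and makes both exact. A module `A` is `Stable` if for some `N` it has weight at
most `N` (the `G_f`-invariants generate `A(V)` as a representation once `deg Z ≥ N`) and the maps
from the `G_f`-coinvariants of `A(V)` to the `G_{f ≫ g}`-coinvariants of `A(V')`, for `g : V ⟶ V'`,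
are bijective once `deg V ≥ deg Z + N`. Weight passes to quotients and, by Maschke, to submodules;
the stabilization conditions pass to kernels and cokernels by four-lemma chases.

The bridge is `presentedInFiniteDegree_iff_stable`. A stable module is generated in bounded degree
(`Spanned.of_weightLE`), and so is the kernel of a cover by an induced module, because that kernel
is again stable. Conversely, free modules are stable: their coinvariants have the `G_f`-orbits on
`Hom(X, V)` as a basis, and these orbits stabilize. `spanned_kernel` moves the bound on relations
from an induced cover to a free one, and the quotient inherits stability.

Geometry enters only through `StabilityCategory`: a Witt-type extension property and the existence
of small hulls. For `SI` both come from splitting off hyperbolic planes. For `VIC` they come from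
subspaces in general position, with a determinant correction for the orientations. -/

namespace CatModule

/-! ### Elementwise calculus of modules over a category -/

section Elementwise

variable {C : Type (u + 1)} [Category.{u} C] {R : Type v} [CommRing R]

/-- The linear map by which a morphism of `C` acts on a `C`-module. -/
abbrev act (A : C ⥤ ModuleCat.{max u v} R) {X Y : C} (f : X ⟶ Y) : A.obj X →ₗ[R] A.obj Y :=
  (A.map f).hom

lemma act_comp (A : C ⥤ ModuleCat.{max u v} R) {X Y Z : C} (f : X ⟶ Y) (g : Y ⟶ Z)
    (x : A.obj X) : act A (f ≫ g) x = act A g (act A f x) := by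
  simp [act]

lemma act_id (A : C ⥤ ModuleCat.{max u v} R) {X : C} (x : A.obj X) : act A (𝟙 X) x = x := by
  simp [act]

/-- The component of a morphism of `C`-modules as a linear map. -/
abbrev comp {A B : C ⥤ ModuleCat.{max u v} R} (φ : A ⟶ B) (X : C) : A.obj X →ₗ[R] B.obj X :=
  (φ.app X).hom

lemma comp_act {A B : C ⥤ ModuleCat.{max u v} R} (φ : A ⟶ B) {X Y : C} (f : X ⟶ Y)
    (x : A.obj X) : comp φ Y (act A f x) = act B f (comp φ X x) := by
  exact congrArg (fun h => h.hom x) (φ.naturality f)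

lemma comp_comp {A B D : C ⥤ ModuleCat.{max u v} R} (φ : A ⟶ B) (ψ : B ⟶ D) (X : C)
    (x : A.obj X) : comp (φ ≫ ψ) X x = comp ψ X (comp φ X x) := rfl

lemma comp_surjective {A B : C ⥤ ModuleCat.{max u v} R} (φ : A ⟶ B) [Epi φ] (X : C) :
    Function.Surjective (comp φ X) :=
  (ModuleCat.epi_iff_surjective _).1 inferInstance

lemma comp_injective {A B : C ⥤ ModuleCat.{max u v} R} (φ : A ⟶ B) [Mono φ] (X : C) :
    Function.Injective (comp φ X) :=
  (ModuleCat.mono_iff_injective _).1 inferInstance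

lemma epi_of_surjective {A B : C ⥤ ModuleCat.{max u v} R} (φ : A ⟶ B)
    (h : ∀ X, Function.Surjective (comp φ X)) : Epi φ := by
  have : ∀ X, Epi (φ.app X) := fun X => (ModuleCat.epi_iff_surjective _).2 (h X)
  exact NatTrans.epi_of_epi_app φ

lemma hom_ext_comp {A B : C ⥤ ModuleCat.{max u v} R} {φ ψ : A ⟶ B}
    (h : ∀ X x, comp φ X x = comp ψ X x) : φ = ψ := by
  ext X x
  exact h X x

/-- Exactness in the category of `C`-modules, elementwise. -/
lemma exists_of_exact {S : ShortComplex (C ⥤ ModuleCat.{max u v} R)} (hS : S.Exact) (X : C)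
    (x : S.X₂.obj X) (hx : comp S.g X x = 0) : ∃ y, comp S.f X y = x := by
  have h := hS.map ((evaluation C (ModuleCat.{max u v} R)).obj X)
  rw [ShortComplex.moduleCat_exact_iff] at h
  exact h x hx

lemma exists_kernel_lift {A B : C ⥤ ModuleCat.{max u v} R} (φ : A ⟶ B) (X : C)
    (x : A.obj X) (hx : comp φ X x = 0) : ∃ y, comp (kernel.ι φ) X y = x :=
  exists_of_exact (ShortComplex.exact_kernel φ) X x hx

lemma comp_kernel_ι {A B : C ⥤ ModuleCat.{max u v} R} (φ : A ⟶ B) (X : C)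
    (x : (kernel φ).obj X) : comp φ X (comp (kernel.ι φ) X x) = 0 := by
  rw [← comp_comp, kernel.condition]
  rfl

/-- A family of submodules of the values of a `C`-module that is stable under `C`. -/
structure SubFamily (A : C ⥤ ModuleCat.{max u v} R) where
  carrier : ∀ X, Submodule R (A.obj X)
  act_mem : ∀ {X Y : C} (f : X ⟶ Y) {x : A.obj X}, x ∈ carrier X → act A f x ∈ carrier Y

/-- The quotient of a `C`-module by a stable family of submodules. -/
def SubFamily.quotient {A : C ⥤ ModuleCat.{max u v} R} (S : SubFamily A) :
    C ⥤ ModuleCat.{max u v} R where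
  obj X := ModuleCat.of R (A.obj X ⧸ S.carrier X)
  map {X Y} f := ModuleCat.ofHom ((S.carrier X).mapQ (S.carrier Y) (act A f)
    fun _ hx => S.act_mem f hx)
  map_id X := by
    ext x
    exact congrArg (S.carrier X).mkQ (act_id A x)
  map_comp {X Y Z} f g := by
    ext x
    exact congrArg (S.carrier Z).mkQ (act_comp A f g x)

/-- The projection onto the quotient by a stable family of submodules. -/
def SubFamily.proj {A : C ⥤ ModuleCat.{max u v} R} (S : SubFamily A) : A ⟶ S.quotient where
  app X := ModuleCat.ofHom (S.carrier X).mkQ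
  naturality X Y f := by
    ext x
    rfl

lemma SubFamily.proj_surjective {A : C ⥤ ModuleCat.{max u v} R} (S : SubFamily A) (X : C) :
    Function.Surjective (comp S.proj X) :=
  Submodule.Quotient.mk_surjective _

lemma SubFamily.proj_eq_zero_iff {A : C ⥤ ModuleCat.{max u v} R} (S : SubFamily A) {X : C}
    (x : A.obj X) : comp S.proj X x = 0 ↔ x ∈ S.carrier X :=
  Submodule.Quotient.mk_eq_zero _

/-- A morphism vanishing on a stable family of submodules descends to the quotient. -/
def SubFamily.desc {A B : C ⥤ ModuleCat.{max u v} R} (S : SubFamily A) (φ : A ⟶ B)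
    (h : ∀ X, ∀ x ∈ S.carrier X, comp φ X x = 0) : S.quotient ⟶ B where
  app X := ModuleCat.ofHom ((S.carrier X).liftQ (comp φ X) (h X))
  naturality X Y f := by
    ext x
    obtain ⟨x, rfl⟩ := Submodule.Quotient.mk_surjective _ x
    exact comp_act φ f x

/-! ### Generation in bounded degree -/

/-- The submodules generated by the elements of degree `≤ d`. -/
def genFamily (deg : C → ℕ) (A : C ⥤ ModuleCat.{max u v} R) (d : ℕ) : SubFamily A where
  carrier V := Submodule.span R {y | ∃ (X : C) (f : X ⟶ V) (x : A.obj X),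
    deg X ≤ d ∧ y = act A f x}
  act_mem {V V'} g x hx := by
    induction hx using Submodule.span_induction with
    | mem x hx =>
      obtain ⟨X, f, x, hX, rfl⟩ := hx
      exact Submodule.subset_span ⟨X, f ≫ g, x, hX, (act_comp A f g x).symm⟩
    | zero => simp
    | add x y _ _ hx hy => rw [map_add]; exact add_mem hx hy
    | smul r x _ hx => rw [map_smul]; exact Submodule.smul_mem _ _ hx

/-- Elementwise version of generation in degree `≤ d`. -/
def Spanned (deg : C → ℕ) (A : C ⥤ ModuleCat.{max u v} R) (d : ℕ) : Prop :=
  ∀ V (x : A.obj V), x ∈ (genFamily deg A d).carrier V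

variable {deg : C → ℕ}

lemma act_mem_genFamily (A : C ⥤ ModuleCat.{max u v} R) {d : ℕ} {X V : C} (f : X ⟶ V)
    (hX : deg X ≤ d) (x : A.obj X) : act A f x ∈ (genFamily deg A d).carrier V :=
  Submodule.subset_span ⟨X, f, x, hX, rfl⟩

lemma mem_genFamily (A : C ⥤ ModuleCat.{max u v} R) {d : ℕ} {V : C} (hV : deg V ≤ d)
    (x : A.obj V) : x ∈ (genFamily deg A d).carrier V := by
  have h := act_mem_genFamily A (𝟙 V) hV x
  rwa [act_id] at h

/-- A morphism that is onto in degrees `≤ d` is onto the submodules generated in degree `≤ d`. -/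
lemma mem_range_of_mem_genFamily {A B : C ⥤ ModuleCat.{max u v} R} (φ : A ⟶ B) {d : ℕ}
    (h : ∀ X, deg X ≤ d → Function.Surjective (comp φ X)) {V : C} {x : B.obj V}
    (hx : x ∈ (genFamily deg B d).carrier V) : x ∈ LinearMap.range (comp φ V) := by
  refine (Submodule.span_le.2 ?_ : (genFamily deg B d).carrier V ≤ _) hx
  rintro _ ⟨X, f, x, hX, rfl⟩
  obtain ⟨y, rfl⟩ := h X hX x
  exact ⟨act A f y, comp_act φ f y⟩

lemma comp_mem_genFamily {A B : C ⥤ ModuleCat.{max u v} R} (φ : A ⟶ B) {d : ℕ} {V : C}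
    {x : A.obj V} (hx : x ∈ (genFamily deg A d).carrier V) :
    comp φ V x ∈ (genFamily deg B d).carrier V := by
  refine (Submodule.span_le.2 ?_ :
    (genFamily deg A d).carrier V ≤ ((genFamily deg B d).carrier V).comap (comp φ V)) hx
  rintro _ ⟨X, f, x, hX, rfl⟩
  exact Submodule.subset_span ⟨X, f, comp φ X x, hX, comp_act φ f x⟩

lemma Spanned.of_surjective {A B : C ⥤ ModuleCat.{max u v} R} (φ : A ⟶ B)
    (h : ∀ X, Function.Surjective (comp φ X)) {d : ℕ} (hA : Spanned deg A d) :
    Spanned deg B d := by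
  intro V x
  obtain ⟨x, rfl⟩ := h V x
  exact comp_mem_genFamily φ (hA V x)

lemma Spanned.surjective {A B : C ⥤ ModuleCat.{max u v} R} (φ : A ⟶ B) {d : ℕ}
    (hB : Spanned deg B d) (h : ∀ X, deg X ≤ d → Function.Surjective (comp φ X)) (V : C) :
    Function.Surjective (comp φ V) :=
  fun x => mem_range_of_mem_genFamily φ h (hB V x)

/-- The component of a unit `W ⟶ Core.inclusion C ⋙ M` as a linear map. -/
abbrev coreComp {W : Core C ⥤ ModuleCat.{max u v} R} {M : C ⥤ ModuleCat.{max u v} R}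
    (η : W ⟶ Core.inclusion C ⋙ M) (X : C) : W.obj ⟨X⟩ →ₗ[R] M.obj X :=
  (η.app ⟨X⟩).hom

/-- The projection of `M` modulo its part generated in degree `≤ d` vanishes on the unit, hence is
zero by the universal property. -/
lemma spanned_of_isInduced {W : Core C ⥤ ModuleCat.{max u v} R} {M : C ⥤ ModuleCat.{max u v} R}
    {η : W ⟶ Core.inclusion C ⋙ M} {d : ℕ} (hW : SupportedLE deg W d) (hM : IsInduced W M η) :
    Spanned deg M d := by
  have hM' : M.IsLeftKanExtension η := hM
  have h0 : (genFamily deg M d).proj = 0 := by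
    refine M.hom_ext_of_isLeftKanExtension η _ _ ?_
    ext X x
    refine ((genFamily deg M d).proj_eq_zero_iff (coreComp η X.of x)).2 ?_
    by_cases hX : deg X.of ≤ d
    · exact mem_genFamily M hX _
    · have := ModuleCat.subsingleton_of_isZero (hW X (by omega))
      have h0 : coreComp η X.of x = 0 := by
        rw [Subsingleton.elim (α := W.obj X) x 0]
        exact map_zero _
      rw [h0]
      exact zero_mem _
  intro V x
  rw [← SubFamily.proj_eq_zero_iff, h0]
  rfl

lemma spanned_of_generatedLE {A : C ⥤ ModuleCat.{max u v} R} {d : ℕ}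
    (h : GeneratedLE deg A d) : Spanned deg A d := by
  obtain ⟨W, M, η, p, hW, hM, hp⟩ := h
  exact (spanned_of_isInduced hW hM).of_surjective p (comp_surjective p)

end Elementwise

end CatModule

namespace CatModule

/-! ### Stability categories -/

/-- The formal properties of a category with a degree function which make the modules over it
presented in finite degree an abelian category. -/
structure StabilityCategory {C : Type (u + 1)} [Category.{u} C] (deg : C → ℕ) : Prop where
  finite_hom : ∀ X Y : C, Finite (X ⟶ Y)
  mono : ∀ {X Y : C} (f : X ⟶ Y), Mono f
  deg_le : ∀ {X Y : C}, (X ⟶ Y) → deg X ≤ deg Y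
  exists_deg_eq : ∀ n, ∃ X, deg X = n
  exists_initial : ∃ O, deg O = 0 ∧ ∀ X, Nonempty (Unique (O ⟶ X))
  -- Witt's theorem: `V = V'` gives transitivity of automorphisms, `P` initial gives existence of
  -- morphisms.
  extend : ∀ {P V V' : C} (i : P ⟶ V) (j : P ⟶ V'), deg V ≤ deg V' → ∃ k : V ⟶ V', i ≫ k = j
  -- Only the difference `deg V₀ - deg Z` is doubled, so the stable ranges below are `deg Z` plus a
  -- constant independent of `Z`. The final `1` pays for a strict inequality of dimensions in `VIC`.
  hull : ∀ {Z V₀ V₁ V : C} (z₀ : Z ⟶ V₀) (z₁ : Z ⟶ V₁) (a : V₀ ⟶ V) (b : V₁ ⟶ V),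
    z₀ ≫ a = z₁ ≫ b → ∃ (K : C) (k : K ⟶ V) (a' : V₀ ⟶ K) (b' : V₁ ⟶ K),
      a' ≫ k = a ∧ b' ≫ k = b ∧ deg K ≤ deg V₁ + 2 * (deg V₀ - deg Z) + 1

namespace StabilityCategory

variable {C : Type (u + 1)} [Category.{u} C] {deg : C → ℕ} (hC : StabilityCategory deg)
include hC

/-- Composition with a monomorphism is an injective, hence surjective, self-map of the finite set of
endomorphisms. -/
lemma isIso_of_endo {V : C} (α : V ⟶ V) : IsIso α := by
  have := hC.finite_hom V V
  have := hC.mono α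
  have hinj : Function.Injective fun β : V ⟶ V => β ≫ α := fun β γ h => (cancel_mono α).1 h
  obtain ⟨β, hβ⟩ := (Finite.injective_iff_surjective.1 hinj) (𝟙 V)
  refine ⟨β, ?_, hβ⟩
  rw [← cancel_mono α, Category.assoc, show β ≫ α = 𝟙 V from hβ]
  simp

lemma nonempty_hom {V V' : C} (h : deg V ≤ deg V') : Nonempty (V ⟶ V') := by
  obtain ⟨O, -, hO⟩ := hC.exists_initial
  obtain ⟨k, -⟩ := hC.extend (hO V).some.default (hO V').some.default h
  exact ⟨k⟩

lemma nonempty_iso {V V' : C} (h : deg V = deg V') : Nonempty (V ≅ V') := by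
  obtain ⟨f⟩ := hC.nonempty_hom h.le
  obtain ⟨g⟩ := hC.nonempty_hom h.ge
  have := hC.isIso_of_endo (f ≫ g)
  have := hC.mono g
  have : IsSplitEpi g := ⟨⟨⟨inv (f ≫ g) ≫ f, by simp⟩⟩⟩
  have := isIso_of_mono_of_isSplitEpi g
  exact ⟨(asIso g).symm⟩

lemma hull_pair {Z X V : C} (z : Z ⟶ V) (h : X ⟶ V) :
    ∃ (K : C) (k : K ⟶ V) (z' : Z ⟶ K) (h' : X ⟶ K),
      z' ≫ k = z ∧ h' ≫ k = h ∧ deg K ≤ deg Z + 2 * deg X + 1 := by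
  obtain ⟨O, hO0, hO⟩ := hC.exists_initial
  obtain ⟨K, k, a', b', ha, hb, hK⟩ := hC.hull (hO X).some.default (hO Z).some.default h z
    (by have := (hO V).some; exact Subsingleton.elim _ _)
  exact ⟨K, k, b', a', hb, ha, by omega⟩

/-- Stabilization of orbits is onto in the stable range. -/
lemma orbit_surjective {Z X V V' : C} (f : Z ⟶ V) (g : V ⟶ V') (h : X ⟶ V')
    (hV : deg Z + (2 * deg X + 1) ≤ deg V) :
    ∃ (α : V' ⟶ V') (h' : X ⟶ V), (f ≫ g) ≫ α = f ≫ g ∧ h ≫ α = h' ≫ g := by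
  -- The hull of `f ≫ g` and `h` is small enough to be moved into `V` relative to `Z`; the move
  -- extends to an automorphism of `V'`.
  obtain ⟨K, k, z', h', hz, hh, hK⟩ := hC.hull_pair (f ≫ g) h
  obtain ⟨j, hj⟩ := hC.extend z' f (V' := V) (by omega)
  obtain ⟨α, hα⟩ := hC.extend k (j ≫ g) le_rfl
  refine ⟨α, h' ≫ j, ?_, ?_⟩
  · rw [← hz, Category.assoc, hα, ← Category.assoc, hj, hz]
  · rw [← hh, Category.assoc, hα, Category.assoc]

/-- Stabilization of orbits is injective in the stable range. -/
lemma orbit_injective {Z X V V' : C} (f : Z ⟶ V) (g : V ⟶ V') (h₁ h₂ : X ⟶ V) (α : V' ⟶ V')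
    (hV : deg Z + (6 * deg X + 4) ≤ deg V) (hα : (f ≫ g) ≫ α = f ≫ g)
    (h : h₁ ≫ g ≫ α = h₂ ≫ g) :
    ∃ β : V ⟶ V, f ≫ β = f ∧ h₁ ≫ β = h₂ := by
  obtain ⟨V₀, i₁, z₀, h₀, hz₀, hh₀, hV₀⟩ := hC.hull_pair f h₁
  obtain ⟨V₁, i₂, z₁, h₁', hz₁, hh₁, hV₁⟩ := hC.hull_pair f h₂
  -- `V₀` and `V₁` have degree at most `deg Z + 2 * deg X + 1`, so this joint hull over `Z` has
  -- degree at most `deg Z + 6 * deg X + 4`. It therefore maps to `V` compatibly with `i₂`, and the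
  -- identity `h₁ ≫ g ≫ α = h₂ ≫ g` in `V'` is transported back to `V`.
  obtain ⟨K, k, a', b', ha, hb, hK⟩ := hC.hull z₀ z₁ (i₁ ≫ g ≫ α) (i₂ ≫ g) (by
    rw [← Category.assoc, hz₀, ← Category.assoc, ← Category.assoc, hz₁, hα])
  have hk := hC.mono k
  obtain ⟨j, hj⟩ := hC.extend b' i₂ (V' := V) (by omega)
  obtain ⟨β, hβ⟩ := hC.extend i₁ (a' ≫ j) le_rfl
  have e₁ : z₀ ≫ a' = z₁ ≫ b' := by
    rw [← cancel_mono k, Category.assoc, ha, Category.assoc, hb, ← Category.assoc, hz₀,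
      ← Category.assoc z₁, hz₁, ← Category.assoc, hα]
  have e₂ : h₀ ≫ a' = h₁' ≫ b' := by
    rw [← cancel_mono k, Category.assoc, ha, Category.assoc, hb, ← Category.assoc, hh₀,
      ← Category.assoc h₁', hh₁, h]
  refine ⟨β, ?_, ?_⟩
  · conv_lhs => rw [← hz₀]
    rw [Category.assoc, hβ, ← Category.assoc, e₁, Category.assoc, hj, hz₁]
  · rw [← hh₀, Category.assoc, hβ, ← Category.assoc, e₂, Category.assoc, hj, hh₁]

/-- The degree determines the isomorphism class. Smallness is needed for the Kan extensions in
`exists_isInduced`. -/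
lemma essentiallySmall : EssentiallySmall.{u} C := by
  rw [essentiallySmall_iff]
  refine ⟨?_, inferInstance⟩
  refine small_of_injective (β := ULift.{u} ℕ) (f := fun X => ⟨deg ((fromSkeleton C).obj X)⟩) ?_
  intro X Y h
  obtain ⟨e⟩ := hC.nonempty_iso (ULift.up_injective h)
  exact skeleton_skeletal C ⟨(fromSkeleton C).preimageIso e⟩

lemma essentiallySmall_core : EssentiallySmall.{u} (Core C) := by
  have := hC.essentiallySmall
  rw [essentiallySmall_congr (equivSmallModel.{u} C).core]
  exact essentiallySmallSelf _

end StabilityCategory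

/-! ### Averaging over stabilizers -/

section Average

variable {C : Type (u + 1)} [Category.{u} C] {R : Type v} [Field R] {deg : C → ℕ}

/-- Averaging over the endomorphisms of `V` fixing `f : Z ⟶ V`. -/
noncomputable def avg (A : C ⥤ ModuleCat.{max u v} R) {Z V : C} (f : Z ⟶ V) :
    A.obj V →ₗ[R] A.obj V :=
  (Nat.card {α : V ⟶ V // f ≫ α = f} : R)⁻¹ • ∑ᶠ α : {α : V ⟶ V // f ≫ α = f}, act A α.1

lemma avg_apply (A : C ⥤ ModuleCat.{max u v} R) {Z V : C} (f : Z ⟶ V)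
    [Fintype {α : V ⟶ V // f ≫ α = f}] (x : A.obj V) :
    avg A f x = (Nat.card {α : V ⟶ V // f ≫ α = f} : R)⁻¹ •
      ∑ α : {α : V ⟶ V // f ≫ α = f}, act A α.1 x := by
  rw [avg, finsum_eq_sum_of_fintype]
  simp

variable (hC : StabilityCategory deg)
include hC

/-- The average lies in every submodule containing the translates. -/
lemma avg_mem (A : C ⥤ ModuleCat.{max u v} R) {Z V : C} (f : Z ⟶ V) (x : A.obj V)
    (S : Submodule R (A.obj V)) (h : ∀ α : V ⟶ V, f ≫ α = f → act A α x ∈ S) :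
    avg A f x ∈ S := by
  have := hC.finite_hom V V
  have := Fintype.ofFinite {α : V ⟶ V // f ≫ α = f}
  rw [avg_apply]
  exact S.smul_mem _ (S.sum_mem fun α _ => h α.1 α.2)

/-- A linear map taking the same value on all translates takes it on the average. -/
lemma map_avg [CharZero R] (A : C ⥤ ModuleCat.{max u v} R) {Z V : C} (f : Z ⟶ V) (x : A.obj V)
    {M : Type*} [AddCommGroup M] [Module R M] (φ : A.obj V →ₗ[R] M) (m : M)
    (h : ∀ α : V ⟶ V, f ≫ α = f → φ (act A α x) = m) : φ (avg A f x) = m := by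
  have := hC.finite_hom V V
  have := Fintype.ofFinite {α : V ⟶ V // f ≫ α = f}
  have : Nonempty {α : V ⟶ V // f ≫ α = f} := ⟨⟨𝟙 V, by simp⟩⟩
  rw [avg_apply, map_smul, map_sum, Finset.sum_congr rfl fun α _ => h α.1 α.2]
  rw [Finset.sum_const, Finset.card_univ, ← Nat.card_eq_fintype_card, ← Nat.cast_smul_eq_nsmul R,
    smul_smul, inv_mul_cancel₀, one_smul]
  exact_mod_cast Nat.card_pos.ne'

lemma comp_avg {A B : C ⥤ ModuleCat.{max u v} R} (φ : A ⟶ B) {Z V : C} (f : Z ⟶ V)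
    (x : A.obj V) : comp φ V (avg A f x) = avg B f (comp φ V x) := by
  have := hC.finite_hom V V
  have := Fintype.ofFinite {α : V ⟶ V // f ≫ α = f}
  rw [avg_apply, avg_apply, map_smul, map_sum]
  simp_rw [comp_act]

lemma act_avg (A : C ⥤ ModuleCat.{max u v} R) {Z V : C} (f : Z ⟶ V) {β : V ⟶ V}
    (hβ : f ≫ β = f) (x : A.obj V) : act A β (avg A f x) = avg A f x := by
  have := hC.finite_hom V V
  have := Fintype.ofFinite {α : V ⟶ V // f ≫ α = f}
  have := hC.mono β
  rw [avg_apply, map_smul, map_sum]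
  congr 1
  refine Fintype.sum_bijective
    (fun α : {α : V ⟶ V // f ≫ α = f} => ⟨α.1 ≫ β, by rw [← Category.assoc, α.2, hβ]⟩) ?_ _ _
    fun α => (act_comp A _ _ _).symm
  refine Finite.injective_iff_bijective.1 fun α γ h => Subtype.ext ?_
  exact (cancel_mono β).1 (congrArg Subtype.val h)

lemma avg_act (A : C ⥤ ModuleCat.{max u v} R) {Z V : C} (f : Z ⟶ V) {β : V ⟶ V}
    (hβ : f ≫ β = f) (x : A.obj V) : avg A f (act A β x) = avg A f x := by
  have := hC.finite_hom V V
  have := Fintype.ofFinite {α : V ⟶ V // f ≫ α = f}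
  have := hC.isIso_of_endo β
  rw [avg_apply, avg_apply]
  congr 1
  refine Fintype.sum_bijective
    (fun α : {α : V ⟶ V // f ≫ α = f} => ⟨β ≫ α.1, by rw [← Category.assoc, hβ, α.2]⟩) ?_ _ _
    fun α => (act_comp A _ _ _).symm
  refine Finite.injective_iff_bijective.1 fun α γ h => Subtype.ext ?_
  exact (cancel_epi β).1 (congrArg Subtype.val h)

lemma avg_eq_self [CharZero R] (A : C ⥤ ModuleCat.{max u v} R) {Z V : C} (f : Z ⟶ V) (x : A.obj V)
    (h : ∀ α : V ⟶ V, f ≫ α = f → act A α x = x) : avg A f x = x :=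
  map_avg hC A f x LinearMap.id x h

lemma avg_avg [CharZero R] (A : C ⥤ ModuleCat.{max u v} R) {Z V : C} (f : Z ⟶ V) (x : A.obj V) :
    avg A f (avg A f x) = avg A f x :=
  avg_eq_self hC A f _ fun _ hα => act_avg hC A f hα x

/-- An automorphism fixing `f` extends along `g` to one fixing `f ≫ g`; hence the stabilization map
is well defined on coinvariants. -/
lemma avg_act_avg [CharZero R] (A : C ⥤ ModuleCat.{max u v} R) {Z V V' : C} (f : Z ⟶ V)
    (g : V ⟶ V') (x : A.obj V) :
    avg A (f ≫ g) (act A g (avg A f x)) = avg A (f ≫ g) (act A g x) := by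
  refine map_avg hC A f x (avg A (f ≫ g) ∘ₗ act A g) _ fun α hα => ?_
  obtain ⟨β, hβ⟩ := hC.extend g (α ≫ g) le_rfl
  have hfβ : (f ≫ g) ≫ β = f ≫ g := by rw [Category.assoc, hβ, ← Category.assoc, hα]
  change avg A (f ≫ g) (act A g (act A α x)) = _
  rw [← act_comp, ← hβ, act_comp, avg_act hC A _ hfβ]

end Average

/-! ### Weight and stable range -/

section Weight

variable {C : Type (u + 1)} [Category.{u} C] {R : Type v} [Field R]

/-- The `C`-module `A` has weight `≤ d`: its value at `V` is generated, as a representation, by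
the invariants of the stabilizer of any `f : Z ⟶ V` with `Z` of degree `≥ d`. -/
def WeightLE (deg : C → ℕ) (A : C ⥤ ModuleCat.{max u v} R) (d : ℕ) : Prop :=
  ∀ ⦃Z V : C⦄ (f : Z ⟶ V), d ≤ deg Z → ∀ x : A.obj V,
    x ∈ Submodule.span R {y | ∃ (α : V ⟶ V) (z : A.obj V), y = act A α (avg A f z)}

/-- The stabilization maps on coinvariants of `A` are onto in the range given by `N`. -/
def StabSurj (deg : C → ℕ) (A : C ⥤ ModuleCat.{max u v} R) (N : ℕ) : Prop :=
  ∀ ⦃Z V V' : C⦄ (f : Z ⟶ V) (g : V ⟶ V'), deg Z + N ≤ deg V → ∀ x' : A.obj V',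
    ∃ x : A.obj V, avg A (f ≫ g) x' = avg A (f ≫ g) (act A g x)

/-- The stabilization maps on coinvariants of `A` are injective in the range given by `N`. -/
def StabInj (deg : C → ℕ) (A : C ⥤ ModuleCat.{max u v} R) (N : ℕ) : Prop :=
  ∀ ⦃Z V V' : C⦄ (f : Z ⟶ V) (g : V ⟶ V'), deg Z + N ≤ deg V → ∀ x : A.obj V,
    avg A (f ≫ g) (act A g x) = 0 → avg A f x = 0

variable {deg : C → ℕ} {A B K : C ⥤ ModuleCat.{max u v} R}

lemma WeightLE.mono {d d' : ℕ} (h : WeightLE deg A d) (hd : d ≤ d') : WeightLE deg A d' :=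
  fun _ _ f hf => h f (hd.trans hf)

lemma StabSurj.mono {d d' : ℕ} (h : StabSurj deg A d) (hd : d ≤ d') : StabSurj deg A d' :=
  fun _ _ _ f g hf => h f g (by omega)

lemma StabInj.mono {d d' : ℕ} (h : StabInj deg A d) (hd : d ≤ d') : StabInj deg A d' :=
  fun _ _ _ f g hf => h f g (by omega)

variable (hC : StabilityCategory deg)
include hC

lemma WeightLE.of_surjective {d : ℕ} (hA : WeightLE deg A d) (φ : A ⟶ B)
    (h : ∀ X, Function.Surjective (comp φ X)) : WeightLE deg B d := by
  intro Z V f hf x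
  obtain ⟨x, rfl⟩ := h V x
  refine (Submodule.span_le.2 ?_ : _ ≤ (Submodule.span R _).comap (comp φ V)) (hA f hf x)
  rintro _ ⟨α, z, rfl⟩
  exact Submodule.subset_span ⟨α, comp φ V z, by rw [comp_act, comp_avg hC]⟩

lemma StabSurj.of_surjective {N : ℕ} (hA : StabSurj deg A N) (φ : A ⟶ B)
    (h : ∀ X, Function.Surjective (comp φ X)) : StabSurj deg B N := by
  intro Z V V' f g hf x
  obtain ⟨x, rfl⟩ := h V' x
  obtain ⟨y, hy⟩ := hA f g hf x
  exact ⟨comp φ V y, by rw [← comp_avg hC, hy, comp_avg hC, comp_act]⟩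

lemma StabInj.of_injective {N : ℕ} (hB : StabInj deg B N) (φ : A ⟶ B)
    (h : ∀ X, Function.Injective (comp φ X)) : StabInj deg A N := by
  intro Z V V' f g hf x hx
  refine h V ?_
  rw [map_zero, comp_avg hC]
  refine hB f g hf _ ?_
  rw [← comp_act, ← comp_avg hC, hx, map_zero]

/-- Bounded weight and a stable range bound the degree of generation. -/
lemma Spanned.of_weightLE {d N : ℕ} (hw : WeightLE deg A d) (hs : StabSurj deg A N) :
    Spanned deg A (d + N) := by
  intro V x
  by_cases hV : deg V ≤ d + N
  · exact mem_genFamily A hV x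
  -- Test objects: `deg Z = d` makes the invariants for `f ≫ g` generate, and `deg V₁ = d + N` makes
  -- these invariants averages of elements coming from `V₁`.
  obtain ⟨Z, hZ⟩ := hC.exists_deg_eq d
  obtain ⟨V₁, hV₁⟩ := hC.exists_deg_eq (d + N)
  obtain ⟨f⟩ := hC.nonempty_hom (V := Z) (V' := V₁) (by omega)
  obtain ⟨g⟩ := hC.nonempty_hom (V := V₁) (V' := V) (by omega)
  refine (Submodule.span_le.2 ?_ : _ ≤ (genFamily deg A (d + N)).carrier V) (hw (f ≫ g) hZ.ge x)
  rintro _ ⟨α, z, rfl⟩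
  refine SubFamily.act_mem _ α ?_
  obtain ⟨y, hy⟩ := hs f g (by omega) z
  rw [hy]
  refine avg_mem hC A _ _ _ fun β _ => ?_
  rw [← act_comp]
  exact act_mem_genFamily A _ hV₁.le y

/-! ### Inheritance by submodules, kernels and cokernels -/

variable [CharZero R]

/-- Maschke's theorem, for the value at `V` of a submodule of a `C`-module. -/
lemma exists_equivariant_retraction (φ : A ⟶ B) (V : C) (h : Function.Injective (comp φ V)) :
    ∃ P : B.obj V →ₗ[R] A.obj V, (∀ x, P (comp φ V x) = x) ∧
      ∀ (α : V ⟶ V) (y : B.obj V), P (act B α y) = act A α (P y) := by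
  obtain ⟨p, hp⟩ := LinearMap.exists_leftInverse_of_injective (comp φ V) (LinearMap.ker_eq_bot.2 h)
  have hp' : ∀ x, p (comp φ V x) = x := fun x => LinearMap.congr_fun hp x
  have := hC.finite_hom V V
  have := Fintype.ofFinite (V ⟶ V)
  have hiso : ∀ α : V ⟶ V, IsIso α := hC.isIso_of_endo
  have hcard : (Nat.card (V ⟶ V) : R) ≠ 0 := by
    have : Nonempty (V ⟶ V) := ⟨𝟙 V⟩
    exact_mod_cast Nat.card_pos.ne'
  refine ⟨(Nat.card (V ⟶ V) : R)⁻¹ • ∑ α : V ⟶ V, act A α ∘ₗ p ∘ₗ act B (inv α), ?_, ?_⟩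
  · intro x
    have : ∀ α : V ⟶ V, act A α (p (act B (inv α) (comp φ V x))) = x := fun α => by
      rw [← comp_act, hp', ← act_comp, IsIso.inv_hom_id, act_id]
    simp only [LinearMap.smul_apply, LinearMap.sum_apply, LinearMap.comp_apply]
    rw [Finset.sum_congr rfl fun α _ => this α, Finset.sum_const, Finset.card_univ,
      ← Nat.card_eq_fintype_card, ← Nat.cast_smul_eq_nsmul R, smul_smul, inv_mul_cancel₀ hcard,
      one_smul]
  · intro β y
    simp only [LinearMap.smul_apply, LinearMap.sum_apply, LinearMap.comp_apply, map_smul, map_sum]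
    congr 1
    symm
    refine Fintype.sum_bijective (fun α => α ≫ β) ?_ _ _ fun α => ?_
    · exact Finite.injective_iff_bijective.1 fun α γ h => (cancel_mono β).1 h
    · rw [← act_comp, ← act_comp, IsIso.inv_comp, ← Category.assoc, IsIso.hom_inv_id,
        Category.id_comp]

/-- An equivariant retraction sends the stabilizer invariants of `B(V)` to those of `A(V)`. -/
lemma WeightLE.of_injective {d : ℕ} (hB : WeightLE deg B d) (φ : A ⟶ B)
    (h : ∀ X, Function.Injective (comp φ X)) : WeightLE deg A d := by
  intro Z V f hf x
  obtain ⟨P, hP, hPα⟩ := exists_equivariant_retraction hC φ V (h V)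
  rw [← hP x]
  refine (Submodule.span_le.2 ?_ : _ ≤ (Submodule.span R _).comap P) (hB f hf (comp φ V x))
  rintro _ ⟨α, z, rfl⟩
  refine Submodule.subset_span ⟨α, P (avg B f z), ?_⟩
  rw [hPα, avg_eq_self hC A f (P (avg B f z))]
  intro β hβ
  rw [← hPα, act_avg hC B f hβ]

/-- Four lemma on coinvariants: a lift to `A(V)` has trivial class in `B(V)` by injectivity for `B`,
so its average comes from `K`. -/
lemma StabSurj.of_kernel {N : ℕ} (hA : StabSurj deg A N) (hB : StabInj deg B N) (ι : K ⟶ A)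
    (φ : A ⟶ B) (hι : ∀ X, Function.Injective (comp ι X))
    (h0 : ∀ X x, comp φ X (comp ι X x) = 0)
    (h : ∀ X x, comp φ X x = 0 → ∃ y, comp ι X y = x) : StabSurj deg K N := by
  intro Z V V' f g hf x'
  obtain ⟨x, hx⟩ := hA f g hf (comp ι V' x')
  have hφ : avg B f (comp φ V x) = 0 := by
    refine hB f g hf _ ?_
    rw [← comp_act, ← comp_avg hC, ← hx, comp_avg hC, h0, map_zero]
  obtain ⟨y, hy⟩ := h V (avg A f x) (by rw [comp_avg hC, hφ])
  refine ⟨y, hι V' ?_⟩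
  rw [comp_avg hC, comp_avg hC, comp_act, hy, hx, avg_act_avg hC]

/-- The dual chase. Exactness at `A` suffices, so for a cokernel `K` can be the source of the map
itself instead of its image. -/
lemma StabInj.of_cokernel {N : ℕ} (hK : StabSurj deg K N) (hA : StabInj deg A N)
    (ι : K ⟶ A) (φ : A ⟶ B) (hφ : ∀ X, Function.Surjective (comp φ X))
    (h0 : ∀ X x, comp φ X (comp ι X x) = 0)
    (h : ∀ X x, comp φ X x = 0 → ∃ y, comp ι X y = x) : StabInj deg B N := by
  intro Z V V' f g hf x hx
  obtain ⟨x, rfl⟩ := hφ V x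
  obtain ⟨y, hy⟩ := h V' (avg A (f ≫ g) (act A g x)) (by rw [comp_avg hC, comp_act, hx])
  obtain ⟨z, hz⟩ := hK f g hf y
  have : avg A f (x - comp ι V z) = 0 := by
    refine hA f g hf _ ?_
    rw [map_sub, map_sub, ← comp_act, ← comp_avg hC, ← hz, comp_avg hC, hy, avg_avg hC, sub_self]
  rw [map_sub, sub_eq_zero] at this
  rw [← comp_avg hC, this, comp_avg hC, h0, map_zero]

end Weight

end CatModule

namespace CatModule

/-! ### Free modules -/

section Free

variable {C : Type (u + 1)} [Category.{u} C] (R : Type v) [Field R]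

/-- The direct sum of the representable `C`-modules of a family of objects. -/
noncomputable def free {ι : Type (max u v)} (X : ι → C) : C ⥤ ModuleCat.{max u v} R where
  obj V := ModuleCat.of R ((Σ i, X i ⟶ V) →₀ R)
  map g := ModuleCat.ofHom (Finsupp.lmapDomain R R fun p => ⟨p.1, p.2 ≫ g⟩)
  map_id V := by
    ext p
    simp
  map_comp f g := by
    ext p
    simp

variable {R}

/-- The basis element of a free module. -/
noncomputable def free.single {ι : Type (max u v)} {X : ι → C} {V : C} (i : ι) (h : X i ⟶ V) :
    (free R X).obj V :=
  Finsupp.single (⟨i, h⟩ : Σ i, X i ⟶ V) (1 : R)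

lemma free.act_single {ι : Type (max u v)} {X : ι → C} {V V' : C} (i : ι) (h : X i ⟶ V)
    (g : V ⟶ V') : act (free R X) g (free.single i h) = free.single i (h ≫ g) :=
  Finsupp.mapDomain_single

lemma free.span_single {ι : Type (max u v)} {X : ι → C} {V : C} (x : (free R X).obj V)
    (S : Submodule R ((free R X).obj V)) (h : ∀ i (f : X i ⟶ V), free.single i f ∈ S) : x ∈ S := by
  induction x using Finsupp.induction_linear with
  | zero => exact S.zero_mem
  | add x y hx hy => exact S.add_mem hx hy
  | single p r =>
    have := S.smul_mem r (h p.1 p.2)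
    have e : r • free.single (R := R) p.1 p.2 = Finsupp.single p r :=
      (Finsupp.smul_single _ _ _).trans (by rw [smul_eq_mul, mul_one])
    rwa [e] at this

/-- The linear map on the value of a free module with prescribed values on the basis. -/
noncomputable def free.lift {ι : Type (max u v)} {X : ι → C} {V : C} {M : Type*} [AddCommGroup M]
    [Module R M] (b : ∀ i, (X i ⟶ V) → M) : (free R X).obj V →ₗ[R] M :=
  Finsupp.linearCombination R fun p : Σ i, X i ⟶ V => b p.1 p.2

lemma free.lift_single {ι : Type (max u v)} {X : ι → C} {V : C} {M : Type*} [AddCommGroup M]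
    [Module R M] (b : ∀ i, (X i ⟶ V) → M) (i : ι) (h : X i ⟶ V) :
    free.lift (R := R) b (free.single i h) = b i h := by
  rw [free.lift, free.single]
  exact (Finsupp.linearCombination_single R _ _).trans (one_smul R _)

lemma free.hom_ext {ι : Type (max u v)} {X : ι → C} {V : C} {M : Type*} [AddCommGroup M]
    [Module R M] {φ ψ : (free R X).obj V →ₗ[R] M}
    (h : ∀ i (f : X i ⟶ V), φ (free.single i f) = ψ (free.single i f)) : φ = ψ := by
  ext x
  exact free.span_single x (LinearMap.eqLocus φ ψ) h

/-- The morphism from a free module given by a family of elements. -/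
noncomputable def free.desc {ι : Type (max u v)} {X : ι → C} (A : C ⥤ ModuleCat.{max u v} R)
    (a : ∀ i, A.obj (X i)) : free R X ⟶ A where
  app V := ModuleCat.ofHom (free.lift fun i f => act A f (a i))
  naturality V V' g := by
    refine ModuleCat.hom_ext (free.hom_ext fun i f => ?_)
    have e : act (free R X) g (free.single i f) = free.single i (f ≫ g) := free.act_single i f g
    refine (congrArg (free.lift fun i f => act A f (a i)) e).trans ?_
    refine (free.lift_single _ _ _).trans ((act_comp A f g (a i)).trans ?_)
    exact congrArg (act A g) (free.lift_single (R := R) (fun i f => act A f (a i)) i f).symm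

lemma free.desc_single {ι : Type (max u v)} {X : ι → C} (A : C ⥤ ModuleCat.{max u v} R)
    (a : ∀ i, A.obj (X i)) {V : C} (i : ι) (h : X i ⟶ V) :
    comp (free.desc A a) V (free.single i h) = act A h (a i) :=
  free.lift_single _ _ _

variable {deg : C → ℕ} {ι : Type (max u v)} {X : ι → C} {d : ℕ}

lemma free.spanned (hX : ∀ i, deg (X i) ≤ d) : Spanned deg (free R X) d := by
  intro V x
  refine free.span_single x _ fun i f => ?_
  rw [← Category.id_comp f, ← free.act_single]
  exact act_mem_genFamily _ f (hX i) _

variable (hC : StabilityCategory deg)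
include hC

lemma Spanned.exists_free {A : C ⥤ ModuleCat.{max u v} R} (hA : Spanned deg A d) :
    ∃ (ι : Type (max u v)) (X : ι → C) (φ : free R X ⟶ A), (∀ i, deg (X i) ≤ d) ∧
      ∀ V, Function.Surjective (comp φ V) := by
  -- One object in each degree suffices, since objects of equal degree are isomorphic.
  choose Y hY using hC.exists_deg_eq
  refine ⟨Σ n : ULift.{max u v} (Fin (d + 1)), A.obj (Y n.down), fun p => Y p.1.down,
    free.desc A fun p => p.2, fun p => ?_, ?_⟩
  · rw [hY]
    omega
  · refine hA.surjective _ fun X hX x => ?_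
    obtain ⟨e⟩ := hC.nonempty_iso (V := X) (V' := Y (deg X)) (hY _).symm
    refine ⟨free.single ⟨⟨⟨deg X, by omega⟩⟩, act A e.hom x⟩ e.inv, ?_⟩
    rw [free.desc_single, ← act_comp, e.hom_inv_id, act_id]

/-- By `orbit_surjective` the stabilizer moves each basis element into the image of `g`, and
averaging does not see the move. -/
lemma free.stabSurj (hX : ∀ i, deg (X i) ≤ d) : StabSurj deg (free R X) (2 * d + 1) := by
  intro Z V V' f g hf x'
  suffices h : avg (free R X) (f ≫ g) x' ∈
      LinearMap.range (avg (free R X) (f ≫ g) ∘ₗ act (free R X) g) by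
    obtain ⟨x, hx⟩ := h
    exact ⟨x, hx.symm⟩
  refine free.span_single x' (Submodule.comap (avg (free R X) (f ≫ g))
      (LinearMap.range (avg (free R X) (f ≫ g) ∘ₗ act (free R X) g))) fun i h => ?_
  have := hX i
  obtain ⟨α, h', hα, hh⟩ := hC.orbit_surjective f g h (by omega)
  refine ⟨free.single i h', ?_⟩
  rw [LinearMap.comp_apply, free.act_single, ← hh, ← free.act_single, avg_act hC _ _ hα]

variable [CharZero R]

/-- A basis element whose morphism factors through `f` is fixed by the stabilizer of `f`, and every
basis element is a translate of such a one. -/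
lemma free.weightLE (hX : ∀ i, deg (X i) ≤ d) : WeightLE deg (free R X) d := by
  intro Z V f hf x
  refine free.span_single x _ fun i h => ?_
  obtain ⟨k⟩ := hC.nonempty_hom ((hX i).trans hf)
  obtain ⟨α, hα⟩ := hC.extend (k ≫ f) h le_rfl
  refine Submodule.subset_span ⟨α, free.single i (k ≫ f), ?_⟩
  rw [avg_eq_self hC, free.act_single, hα]
  intro β hβ
  rw [free.act_single, Category.assoc, hβ]

/-- An inverse on coinvariants is built: `ρ` sends the basis element of `h` to the average of `s i
h`, a representative of its orbit that comes from `V`. By `orbit_injective` the choice does not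
matter, so `ρ` is invariant and `ρ ∘ g` is the average over the stabilizer of `f`. -/
lemma free.stabInj (hX : ∀ i, deg (X i) ≤ d) : StabInj deg (free R X) (6 * d + 4) := by
  intro Z V V' f g hf x hx
  have hs : ∀ (i : ι) (h : X i ⟶ V'), ∃ (α : V' ⟶ V') (h' : X i ⟶ V),
      (f ≫ g) ≫ α = f ≫ g ∧ h ≫ α = h' ≫ g := fun i h =>
    hC.orbit_surjective f g h (by have := hX i; omega)
  choose α s hα hs using hs
  have hinj : ∀ (i : ι) (h₁ h₂ : X i ⟶ V) (γ : V' ⟶ V'), (f ≫ g) ≫ γ = f ≫ g →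
      h₁ ≫ g ≫ γ = h₂ ≫ g →
      avg (free R X) f (free.single i h₁) = avg (free R X) f (free.single i h₂) := by
    intro i h₁ h₂ γ hγ h
    obtain ⟨β, hβ, rfl⟩ := hC.orbit_injective f g h₁ h₂ γ (by have := hX i; omega) hγ h
    rw [← free.act_single, avg_act hC _ _ hβ]
  let ρ : (free R X).obj V' →ₗ[R] (free R X).obj V :=
    free.lift fun i h => avg (free R X) f (free.single i (s i h))
  have hρ : ∀ γ : V' ⟶ V', (f ≫ g) ≫ γ = f ≫ g → ρ ∘ₗ act (free R X) γ = ρ := by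
    intro γ hγ
    refine free.hom_ext fun i h => ?_
    rw [LinearMap.comp_apply, free.act_single, free.lift_single, free.lift_single]
    have hiso := hC.isIso_of_endo (α i h)
    have hinv : (f ≫ g) ≫ inv (α i h) = f ≫ g := by
      rw [IsIso.comp_inv_eq, hα]
    refine (hinj i _ _ (inv (α i h) ≫ γ ≫ α i (h ≫ γ)) ?_ ?_).symm
    · rw [← Category.assoc, hinv, ← Category.assoc, hγ, hα]
    · rw [← hs i (h ≫ γ), ← Category.assoc, ← hs i h]
      simp
  have hρg : ρ ∘ₗ act (free R X) g = avg (free R X) f := by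
    refine free.hom_ext fun i h => ?_
    rw [LinearMap.comp_apply, free.act_single, free.lift_single]
    refine (hinj i _ _ (α i (h ≫ g)) (hα i _) ?_).symm
    rw [← hs i (h ≫ g), Category.assoc]
  have := map_avg hC (free R X) (f ≫ g) (act (free R X) g x) ρ (ρ (act (free R X) g x))
    fun γ hγ => LinearMap.congr_fun (hρ γ hγ) _
  rw [hx, map_zero, ← LinearMap.comp_apply, hρg] at this
  exact this.symm

end Free

/-! ### Presentation in finite degree -/

section Presented

variable {C : Type (u + 1)} [Category.{u} C] {R : Type v} [Field R]
  {deg : C → ℕ}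

/-- A morphism of `Core C`-modules obtained by lifting along a morphism of `C`-modules that is
bijective in the degrees in which the source is supported. -/
lemma exists_lift_of_bijective {W : Core C ⥤ ModuleCat.{max u v} R}
    {A Q : C ⥤ ModuleCat.{max u v} R} {d : ℕ} (hW : SupportedLE deg W d)
    (β : W ⟶ Core.inclusion C ⋙ A) (q : Q ⟶ A)
    (hq : ∀ X, deg X ≤ d → Function.Bijective (comp q X)) :
    ∃ γ : W ⟶ Core.inclusion C ⋙ Q, γ ≫ Functor.whiskerLeft (Core.inclusion C) q = β := by
  have h : ∀ X : Core C, ∃ c : W.obj X →ₗ[R] Q.obj X.of,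
      comp q X.of ∘ₗ c = coreComp β X.of := by
    intro X
    by_cases hX : deg X.of ≤ d
    · refine ⟨(LinearEquiv.ofBijective _ (hq X.of hX)).symm.toLinearMap ∘ₗ coreComp β X.of, ?_⟩
      ext x
      exact (LinearEquiv.ofBijective _ (hq X.of hX)).apply_symm_apply _
    · have := ModuleCat.subsingleton_of_isZero (hW X (by omega))
      refine ⟨0, ?_⟩
      ext x
      rw [Subsingleton.elim (α := W.obj X) x 0, map_zero]
      exact (map_zero (coreComp β X.of)).symm
  choose c hc using h
  refine ⟨⟨fun X => ModuleCat.ofHom (c X), fun X Y f => ?_⟩, ?_⟩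
  · ext x
    by_cases hX : deg Y.of ≤ d
    · apply (hq Y.of hX).1
      have h1 : comp q Y.of (c Y ((W.map f).hom x)) = coreComp β Y.of ((W.map f).hom x) :=
        LinearMap.congr_fun (hc Y) _
      have h2 : comp q X.of (c X x) = coreComp β X.of x := LinearMap.congr_fun (hc X) x
      have h3 : coreComp β Y.of ((W.map f).hom x) = act A f.iso.hom (coreComp β X.of x) :=
        congrArg (fun h => h.hom x) (β.naturality f)
      exact h1.trans (h3.trans ((congrArg _ h2.symm).trans (comp_act q f.iso.hom (c X x)).symm))
    · have hz := (hW Y (by omega)).of_iso (W.mapIso (Groupoid.isoEquivHom _ _ |>.symm f))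
      have := ModuleCat.subsingleton_of_isZero hz
      rw [Subsingleton.elim (α := W.obj X) x 0, map_zero, map_zero]
  · ext X x
    exact LinearMap.congr_fun (hc X) x

/-- Relations of bounded degree for one presentation bound the degree of the relations for any
other surjection from a module generated in bounded degree. -/
lemma spanned_kernel {W : Core C ⥤ ModuleCat.{max u v} R} {M A P : C ⥤ ModuleCat.{max u v} R}
    {η : W ⟶ Core.inclusion C ⋙ M} {p : M ⟶ A} {d r : ℕ} (hW : SupportedLE deg W d)
    (hM : IsInduced W M η) (hp : ∀ X, Function.Surjective (comp p X))
    (hr : Spanned deg (kernel p) r) (q : P ⟶ A) (hq : ∀ X, Function.Surjective (comp q X))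
    (hP : Spanned deg P d) : Spanned deg (kernel q) (max d r) := by
  have hM' : M.IsLeftKanExtension η := hM
  set m := max d r with hm
  have hdm : d ≤ m := le_max_left _ _
  have hrm : r ≤ m := le_max_right _ _
  -- `S` is the part of `ker q` generated in degree `≤ m`. The aim is that `q' : P / S ⟶ A` is
  -- injective.
  let S : SubFamily P :=
    { carrier := fun X => ((genFamily deg (kernel q) m).carrier X).map (comp (kernel.ι q) X)
      act_mem := by
        rintro X Y f _ ⟨x, hx, rfl⟩
        exact ⟨act _ f x, SubFamily.act_mem _ f hx, comp_act _ f x⟩ }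
  let q' : S.quotient ⟶ A := S.desc q (by
    rintro X _ ⟨x, -, rfl⟩
    exact comp_kernel_ι q X x)
  have hq'surj : ∀ X, Function.Surjective (comp q' X) := fun X x => by
    obtain ⟨y, rfl⟩ := hq X x
    exact ⟨comp S.proj X y, rfl⟩
  have hq'inj : ∀ X, deg X ≤ m → ∀ y, comp q' X y = 0 → y = 0 := by
    intro X hX y hy
    obtain ⟨y, rfl⟩ := S.proj_surjective X y
    obtain ⟨z, rfl⟩ := exists_kernel_lift q X y hy
    rw [SubFamily.proj_eq_zero_iff]
    exact ⟨z, mem_genFamily _ hX z, rfl⟩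
  have hbij : ∀ X, deg X ≤ d → Function.Bijective (comp q' X) := fun X hX =>
    ⟨(injective_iff_map_eq_zero _).2 fun y hy => hq'inj X (hX.trans hdm) y hy, hq'surj X⟩
  -- `W` lives where `q'` is bijective, so its map to `A` lifts to `P / S` without any projectivity,
  -- and `M` being induced extends the lift to `σ`.
  obtain ⟨γ, hγ⟩ := exists_lift_of_bijective hW (η ≫ Functor.whiskerLeft (Core.inclusion C) p)
    q' hbij
  let σ : M ⟶ S.quotient := M.descOfIsLeftKanExtension η _ γ
  have hσ : σ ≫ q' = p := by
    refine M.hom_ext_of_isLeftKanExtension η _ _ ?_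
    rw [Functor.whiskerLeft_comp, ← Category.assoc, M.descOfIsLeftKanExtension_fac, hγ]
  have hσ' : ∀ X x, comp q' X (comp σ X x) = comp p X x := fun X x => by
    rw [← comp_comp, hσ]
  -- The generators of `ker p` lie in degrees `≤ r`, where `q'` is injective, and `σ ≫ q' = p` kills
  -- them.
  have hσ0 : kernel.ι p ≫ σ = 0 := by
    have hd : (genFamily deg (kernel p) r).proj = 0 → kernel.ι p ≫ σ = 0 := fun _ => ?_
    · refine hd (hom_ext_comp fun X x => ((genFamily deg (kernel p) r).proj_eq_zero_iff x).2
        (hr X x))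
    · refine hom_ext_comp fun X x => ?_
      have hx := hr X x
      refine (Submodule.span_le.2 ?_ :
        (genFamily deg (kernel p) r).carrier X ≤ LinearMap.ker (comp (kernel.ι p ≫ σ) X)) hx
      rintro _ ⟨Y, f, y, hY, rfl⟩
      change comp (kernel.ι p ≫ σ) X (act _ f y) = 0
      rw [comp_act, comp_comp, hq'inj Y (hY.trans hrm) (comp σ Y (comp (kernel.ι p) Y y)), map_zero]
      rw [hσ', comp_kernel_ι]
  have hσsurj : ∀ X, Function.Surjective (comp σ X) := by
    refine (hP.of_surjective S.proj S.proj_surjective).surjective σ fun X hX y => ?_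
    obtain ⟨x, hx⟩ := hp X (comp q' X y)
    refine ⟨x, (hbij X hX).1 ?_⟩
    rw [hσ', hx]
  -- Since `σ` is onto, the class of `x` lifts to `ker p`, which `σ` kills. Hence `x` lies in `S`.
  intro V x
  obtain ⟨y, hy⟩ := hσsurj V (comp S.proj V (comp (kernel.ι q) V x))
  have hpy : comp p V y = 0 := by
    rw [← hσ', hy]
    exact comp_kernel_ι q V x
  obtain ⟨z, rfl⟩ := exists_kernel_lift p V y hpy
  rw [← comp_comp, hσ0] at hy
  obtain ⟨w, hw, hwx⟩ := (S.proj_eq_zero_iff _).1 hy.symm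
  rwa [comp_injective (kernel.ι q) V hwx] at hw

/-- Bounded weight and a stable range for the stabilization maps on coinvariants. -/
def Stable (deg : C → ℕ) (A : C ⥤ ModuleCat.{max u v} R) : Prop :=
  ∃ N, WeightLE deg A N ∧ StabSurj deg A N ∧ StabInj deg A N

lemma Stable.of_isZero {A : C ⥤ ModuleCat.{max u v} R} (hA : IsZero A) : Stable deg A := by
  have h0 : ∀ X (x : A.obj X), x = 0 := fun X x => by
    have : 𝟙 A = 0 := hA.eq_of_src _ _
    exact congrArg (fun φ : A ⟶ A => comp φ X x) this
  refine ⟨0, fun Z V f _ x => ?_, fun Z V V' f g _ x => ⟨0, ?_⟩, fun Z V V' f g _ x _ => h0 _ _⟩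
  · rw [h0 V x]
    exact zero_mem _
  · rw [h0 V' x, map_zero, map_zero, map_zero]

variable (hC : StabilityCategory deg)
include hC

/-- An extension, split on the level of elements, of stable modules is stable. -/
lemma Stable.of_split {A B E : C ⥤ ModuleCat.{max u v} R} (hA : Stable deg A) (hB : Stable deg B)
    (i : A ⟶ E) (j : B ⟶ E) (p : E ⟶ A) (q : E ⟶ B)
    (h : p ≫ i + q ≫ j = 𝟙 E) : Stable deg E := by
  have h' : ∀ X x, comp i X (comp p X x) + comp j X (comp q X x) = x := fun X x =>
    congrArg (fun φ : E ⟶ E => comp φ X x) h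
  obtain ⟨n, a1, a2, a3⟩ := hA
  obtain ⟨m, b1, b2, b3⟩ := hB
  replace a1 := a1.mono (le_max_left n m)
  replace b1 := b1.mono (le_max_right n m)
  replace a2 := a2.mono (le_max_left n m)
  replace b2 := b2.mono (le_max_right n m)
  replace a3 := a3.mono (le_max_left n m)
  replace b3 := b3.mono (le_max_right n m)
  refine ⟨max n m, fun Z V f hf x => ?_, fun Z V V' f g hf x => ?_, fun Z V V' f g hf x hx => ?_⟩
  · rw [← h' V x]
    refine add_mem ?_ ?_
    · refine (Submodule.span_le.2 ?_ : _ ≤ (Submodule.span R _).comap (comp i V))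
        (a1 f hf (comp p V x))
      rintro _ ⟨α, z, rfl⟩
      exact Submodule.subset_span ⟨α, comp i V z, by rw [comp_act, comp_avg hC]⟩
    · refine (Submodule.span_le.2 ?_ : _ ≤ (Submodule.span R _).comap (comp j V))
        (b1 f hf (comp q V x))
      rintro _ ⟨α, z, rfl⟩
      exact Submodule.subset_span ⟨α, comp j V z, by rw [comp_act, comp_avg hC]⟩
  · obtain ⟨y, hy⟩ := a2 f g hf (comp p V' x)
    obtain ⟨z, hz⟩ := b2 f g hf (comp q V' x)
    refine ⟨comp i V y + comp j V z, ?_⟩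
    conv_lhs => rw [← h' V' x]
    rw [map_add, map_add, map_add, ← comp_avg hC i, ← comp_avg hC j, hy, hz, comp_avg hC i,
      comp_avg hC j, comp_act, comp_act]
  · rw [← h' V (avg E f x), comp_avg hC p, comp_avg hC q, a3 f g hf (comp p V x),
      b3 f g hf (comp q V x), map_zero, map_zero, add_zero]
    · rw [← comp_act, ← comp_avg hC, hx, map_zero]
    · rw [← comp_act, ← comp_avg hC, hx, map_zero]

lemma exists_isInduced (W : Core C ⥤ ModuleCat.{max u v} R) :
    ∃ (M : C ⥤ ModuleCat.{max u v} R) (η : W ⟶ Core.inclusion C ⋙ M), IsInduced W M η := by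
  have := hC.essentiallySmall_core
  have h1 : HasColimitsOfSize.{u, u} (ModuleCat.{max u v} R) :=
    hasColimitsOfSizeShrink.{u, u, max u v, max u v} _
  have h2 : (Core.inclusion C).HasPointwiseLeftKanExtension W := fun Y => by
    have := hasColimitsOfShape_of_essentiallySmall.{u}
      (CostructuredArrow (Core.inclusion C) Y) (ModuleCat.{max u v} R)
    exact HasColimitsOfShape.has_colimit _
  have h3 : (Core.inclusion C).HasLeftKanExtension W := inferInstance
  exact ⟨(Core.inclusion C).leftKanExtension W, (Core.inclusion C).leftKanExtensionUnit W,
    inferInstance⟩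

/-- A module generated in degree `≤ d` is a quotient of an induced module. -/
lemma Spanned.exists_induced {A : C ⥤ ModuleCat.{max u v} R} {d : ℕ} (hA : Spanned deg A d) :
    ∃ (W : Core C ⥤ ModuleCat.{max u v} R) (M : C ⥤ ModuleCat.{max u v} R)
      (η : W ⟶ Core.inclusion C ⋙ M) (p : M ⟶ A),
      SupportedLE deg W d ∧ IsInduced W M η ∧ Epi p := by
  classical
  -- `W` is the restriction of `A`, cut off above degree `d`; isomorphisms preserve the degree.
  let T : ∀ X, Submodule R (A.obj X) := fun X => if deg X ≤ d then ⊤ else ⊥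
  have hT : ∀ {X Y : C} (f : X ≅ Y), T X ≤ (T Y).comap (act A f.hom) := by
    intro X Y f
    have : deg X = deg Y := le_antisymm (hC.deg_le f.hom) (hC.deg_le f.inv)
    by_cases hX : deg X ≤ d
    · simp [T, ← this, hX]
    · simp [T, hX]
  let W : Core C ⥤ ModuleCat.{max u v} R :=
    { obj := fun X => ModuleCat.of R (T X.of)
      map := fun f => ModuleCat.ofHom ((act A f.iso.hom).restrict (hT f.iso))
      map_id := fun X => by
        ext x
        exact act_id A (x : A.obj X.of)
      map_comp := fun {X Y Z} f g => by
        ext x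
        exact act_comp A f.iso.hom g.iso.hom (x : A.obj X.of) }
  let β : W ⟶ Core.inclusion C ⋙ A :=
    { app := fun X => ModuleCat.ofHom (T X.of).subtype
      naturality := fun X Y f => by
        ext x
        rfl }
  obtain ⟨M, η, hM⟩ := exists_isInduced (R := R) hC W
  have hM' : M.IsLeftKanExtension η := hM
  refine ⟨W, M, η, M.descOfIsLeftKanExtension η _ β, ?_, hM, epi_of_surjective _ ?_⟩
  · intro X hX
    have : Subsingleton (T X.of) := by
      rw [show T X.of = ⊥ from if_neg (by omega)]
      infer_instance
    exact ModuleCat.isZero_of_subsingleton _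
  · refine hA.surjective _ fun X hX x => ?_
    have hx : x ∈ T X := by simp [T, hX]
    refine ⟨coreComp η X (⟨x, hx⟩ : T X), ?_⟩
    exact congrArg (fun h => h.hom (⟨x, hx⟩ : T X))
      (M.descOfIsLeftKanExtension_fac_app η A β ⟨X⟩)

lemma Spanned.generatedLE {A : C ⥤ ModuleCat.{max u v} R} {d : ℕ} (hA : Spanned deg A d) :
    GeneratedLE deg A d :=
  hA.exists_induced hC

variable [CharZero R]

/-- A free cover of `ker q` gives it surjective stabilization, which is all that injectivity for the
quotient needs from the relations. -/
lemma Stable.of_relations {A P : C ⥤ ModuleCat.{max u v} R} {r : ℕ} (q : P ⟶ A)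
    (hq : ∀ X, Function.Surjective (comp q X)) (hP : Stable deg P)
    (hr : Spanned deg (kernel q) r) : Stable deg A := by
  obtain ⟨ι, X, φ, hX, hφ⟩ := hr.exists_free hC
  obtain ⟨N, h1, h2, h3⟩ := hP
  have hs := StabSurj.of_surjective hC (free.stabSurj (R := R) hC hX) φ hφ
  refine ⟨max N (2 * r + 1), (WeightLE.of_surjective hC h1 q hq).mono (le_max_left _ _),
    (StabSurj.of_surjective hC h2 q hq).mono (le_max_left _ _), ?_⟩
  exact StabInj.of_cokernel hC (StabSurj.mono hs (le_max_right _ _))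
    (StabInj.mono h3 (le_max_left _ _))
    (kernel.ι q) q hq (comp_kernel_ι q) (exists_kernel_lift q)

/-- A quotient of an induced module supported in bounded degrees, with relations of bounded degree,
is stable. -/
lemma Stable.of_isInduced {W : Core C ⥤ ModuleCat.{max u v} R} {M A : C ⥤ ModuleCat.{max u v} R}
    {η : W ⟶ Core.inclusion C ⋙ M} {p : M ⟶ A} {d r : ℕ} (hW : SupportedLE deg W d)
    (hM : IsInduced W M η) (hp : ∀ X, Function.Surjective (comp p X))
    (hr : Spanned deg (kernel p) r) : Stable deg A := by
  obtain ⟨ι, X, φ, hX, hφ⟩ :=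
    Spanned.exists_free hC ((spanned_of_isInduced hW hM).of_surjective p hp)
  refine Stable.of_relations hC φ hφ ⟨6 * d + 4, ?_, ?_, ?_⟩
    (spanned_kernel hW hM hp hr φ hφ (free.spanned hX))
  · exact (free.weightLE hC hX).mono (by omega)
  · exact (free.stabSurj hC hX).mono (by omega)
  · exact free.stabInj hC hX

lemma Stable.of_isInduced_self {W : Core C ⥤ ModuleCat.{max u v} R}
    {M : C ⥤ ModuleCat.{max u v} R} {η : W ⟶ Core.inclusion C ⋙ M} {d : ℕ}
    (hW : SupportedLE deg W d) (hM : IsInduced W M η) : Stable deg M := by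
  refine Stable.of_isInduced hC (p := 𝟙 M) (r := 0) hW hM (fun X x => ⟨x, rfl⟩) fun V x => ?_
  have : x = 0 := comp_injective (kernel.ι (𝟙 M)) V ((comp_kernel_ι (𝟙 M) V x).trans
    (map_zero _).symm)
  rw [this]
  exact zero_mem _

lemma Stable.of_kernel {K A B : C ⥤ ModuleCat.{max u v} R} (hA : Stable deg A) (hB : Stable deg B)
    (ι : K ⟶ A) (φ : A ⟶ B) (hι : ∀ X, Function.Injective (comp ι X))
    (h0 : ∀ X x, comp φ X (comp ι X x) = 0)
    (h : ∀ X x, comp φ X x = 0 → ∃ y, comp ι X y = x) : Stable deg K := by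
  obtain ⟨n, a1, a2, a3⟩ := hA
  obtain ⟨m, -, -, b3⟩ := hB
  exact ⟨max n m, (WeightLE.of_injective hC a1 ι hι).mono (le_max_left _ _),
    StabSurj.of_kernel hC (a2.mono (le_max_left _ _)) (b3.mono (le_max_right _ _)) ι φ hι h0 h,
    (StabInj.of_injective hC a3 ι hι).mono (le_max_left _ _)⟩

lemma Stable.of_cokernel {K A B : C ⥤ ModuleCat.{max u v} R} (hK : Stable deg K)
    (hA : Stable deg A) (ι : K ⟶ A) (φ : A ⟶ B) (hφ : ∀ X, Function.Surjective (comp φ X))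
    (h0 : ∀ X x, comp φ X (comp ι X x) = 0)
    (h : ∀ X x, comp φ X x = 0 → ∃ y, comp ι X y = x) : Stable deg B := by
  obtain ⟨n, a1, a2, a3⟩ := hA
  obtain ⟨m, -, b2, -⟩ := hK
  exact ⟨max n m, (WeightLE.of_surjective hC a1 φ hφ).mono (le_max_left _ _),
    (StabSurj.of_surjective hC a2 φ hφ).mono (le_max_left _ _),
    StabInj.of_cokernel hC (b2.mono (le_max_right _ _)) (a3.mono (le_max_left _ _)) ι φ hφ h0 h⟩

/-- Being presented in finite degree is a bound on the weight together with a stable range. -/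
theorem presentedInFiniteDegree_iff_stable (A : C ⥤ ModuleCat.{max u v} R) :
    presentedInFiniteDegree R deg A ↔ Stable deg A := by
  constructor
  · rintro ⟨n, -, r, -, ⟨d, W, M, η, p, hW, hM, hp, hr⟩, -⟩
    exact Stable.of_isInduced hC hW hM (comp_surjective p) (spanned_of_generatedLE hr)
  · intro hA
    obtain ⟨N, h1, h2, h3⟩ := id hA
    obtain ⟨W, M, η, p, hW, hM, hp⟩ := (Spanned.of_weightLE hC h1 h2).exists_induced hC
    -- Both `M` and `A` are stable, so the module of relations is stable and thus generated in
    -- bounded degree.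
    obtain ⟨N', k1, k2, -⟩ := Stable.of_kernel hC (Stable.of_isInduced_self hC hW hM) hA
      (kernel.ι p) p (comp_injective _) (comp_kernel_ι p) (exists_kernel_lift p)
    exact ⟨_, N + N, N' + N', ⟨W, M, η, p, hW, hM, hp⟩,
      ⟨N + N, W, M, η, p, hW, hM, hp, (Spanned.of_weightLE hC k1 k2).generatedLE hC⟩, le_rfl⟩

/-! ### Closure properties -/

lemma isClosedUnderKernels : (presentedInFiniteDegree R deg).IsClosedUnderKernels := by
  refine ⟨?_⟩
  rintro _ ⟨f, k, hk, hA, hB⟩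
  rw [presentedInFiniteDegree_iff_stable hC] at hA hB ⊢
  have := mono_of_isLimit_fork hk
  refine Stable.of_kernel hC hA hB k.ι f (comp_injective _) (fun X x => ?_) fun X x hx => ?_
  · rw [← comp_comp, k.condition]
    rfl
  · obtain ⟨y, rfl⟩ := exists_kernel_lift f X x hx
    obtain ⟨l, hl⟩ := KernelFork.IsLimit.lift' hk (kernel.ι f) (kernel.condition f)
    exact ⟨comp l X y, by rw [← comp_comp, hl]⟩

lemma isClosedUnderCokernels : (presentedInFiniteDegree R deg).IsClosedUnderCokernels := by
  refine ⟨?_⟩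
  rintro _ ⟨f, k, hk, hA, hB⟩
  rw [presentedInFiniteDegree_iff_stable hC] at hA hB ⊢
  have := epi_of_isColimit_cofork hk
  refine Stable.of_cokernel hC hA hB f k.π (comp_surjective _) (fun X x => ?_) fun X x hx => ?_
  · rw [← comp_comp, k.condition]
    rfl
  · obtain ⟨l, hl⟩ := CokernelCofork.IsColimit.desc' hk (cokernel.π f) (cokernel.condition f)
    refine exists_of_exact (ShortComplex.exact_cokernel f) X x ?_
    change comp (cokernel.π f) X x = 0
    rw [← hl, comp_comp, hx, map_zero]

lemma isClosedUnderFiniteProducts :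
    (presentedInFiniteDegree R deg).IsClosedUnderFiniteProducts := by
  have hz : (presentedInFiniteDegree R deg).ContainsZero :=
    ⟨⟨_, isZero_zero _, (presentedInFiniteDegree_iff_stable hC _).2
      (Stable.of_isZero (isZero_zero _))⟩⟩
  have hiso : (presentedInFiniteDegree R deg).IsClosedUnderIsomorphisms := by
    refine ⟨fun {A B} e hA => ?_⟩
    rw [presentedInFiniteDegree_iff_stable hC] at hA ⊢
    exact Stable.of_split hC hA hA e.hom 0 e.inv 0 (by simp)
  have hprod : (presentedInFiniteDegree R deg).IsClosedUnderBinaryProducts := by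
    refine ⟨?_⟩
    rintro X ⟨p⟩
    have hA := p.prop_diag_obj ⟨WalkingPair.left⟩
    have hB := p.prop_diag_obj ⟨WalkingPair.right⟩
    have e : X ≅ p.diag.obj ⟨WalkingPair.left⟩ ⊞ p.diag.obj ⟨WalkingPair.right⟩ :=
      IsLimit.conePointsIsoOfNatIso p.isLimit (BinaryBiproduct.isLimit _ _)
        (diagramIsoPair p.diag)
    refine (presentedInFiniteDegree R deg).prop_of_iso e.symm ?_
    rw [presentedInFiniteDegree_iff_stable hC] at hA hB ⊢
    exact Stable.of_split hC hA hB biprod.inl biprod.inr biprod.fst biprod.snd biprod.total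
  exact ObjectProperty.IsClosedUnderFiniteProducts.mk'

/-- Over a stability category, the modules presented in finite degree form an abelian subcategory,
closed under kernels and cokernels. -/
theorem abelian_presentedInFiniteDegree :
    (presentedInFiniteDegree R deg).IsClosedUnderKernels ∧
      (presentedInFiniteDegree R deg).IsClosedUnderCokernels ∧
      Nonempty (Abelian (presentedInFiniteDegree R deg).FullSubcategory) := by
  have h1 := isClosedUnderKernels (R := R) hC
  have h2 := isClosedUnderCokernels (R := R) hC
  have h3 := isClosedUnderFiniteProducts (R := R) hC
  have hz : (presentedInFiniteDegree R deg).ContainsZero :=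
    ⟨⟨_, isZero_zero _, (presentedInFiniteDegree_iff_stable hC _).2
      (Stable.of_isZero (isZero_zero _))⟩⟩
  exact ⟨h1, h2, ⟨inferInstance⟩⟩

end Presented

end CatModule

namespace SI

/-! ### Symplectic spaces form a stability category -/

variable {k : Type u} [Field k]

@[ext]
lemma hom_ext {V W : SI k} {f g : V ⟶ W} (h : ∀ x, Hom.toLin f x = Hom.toLin g x) : f = g :=
  Hom.ext (LinearMap.ext h)

lemma comp_toLin {V W X : SI k} (f : V ⟶ W) (g : W ⟶ X) (x : V) :
    Hom.toLin (f ≫ g) x = Hom.toLin g (Hom.toLin f x) := rfl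

instance mono {V W : SI k} (f : V ⟶ W) : Mono f :=
  ⟨fun _ _ e => hom_ext fun x => Hom.injective f (congrArg (fun l => Hom.toLin l x) e)⟩

lemma finrank_le {V W : SI k} (f : V ⟶ W) : Module.finrank k V ≤ Module.finrank k W :=
  LinearMap.finrank_le_finrank_of_injective (Hom.injective f)

lemma finite_hom [Finite k] (V W : SI k) : Finite (V ⟶ W) := by
  have := Module.finite_of_finite k (M := V)
  have := Module.finite_of_finite k (M := W)
  exact Finite.of_injective (fun f : V ⟶ W => (Hom.toLin f : V → W)) fun f g h =>
    hom_ext fun x => congrFun h x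

/-- The zero symplectic space. -/
def zero (k : Type u) [Field k] : SI k where
  carrier := PUnit.{u + 1}
  form := 0
  isAlt := fun _ => rfl
  nondegenerate := ⟨fun _ _ => Subsingleton.elim _ _, fun _ _ => Subsingleton.elim _ _⟩

/-- The embedding of the zero symplectic space. -/
def fromZero (V : SI k) : zero k ⟶ V where
  toLin := 0
  injective := fun x y _ => Subsingleton.elim (α := PUnit) x y
  isometry := fun _ _ => LinearMap.map_zero₂ V.form 0

lemma finrank_zero : Module.finrank k (zero k) = 0 :=
  Module.finrank_zero_of_subsingleton (M := PUnit.{u + 1})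

instance (V : SI k) : Unique (zero k ⟶ V) where
  default := fromZero V
  uniq f := hom_ext fun x => by
    rw [show x = 0 from Subsingleton.elim (α := PUnit) _ _, map_zero, map_zero]

/-- The form of the orthogonal sum of a symplectic space with a hyperbolic plane. -/
def hypForm (P : SI k) : LinearMap.BilinForm k (P × k × k) :=
  LinearMap.mk₂ k (fun v w => P.form v.1 w.1 + (v.2.1 * w.2.2 - v.2.2 * w.2.1))
    (fun _ _ _ => by simp; ring) (fun _ _ _ => by simp; ring)
    (fun _ _ _ => by simp; ring) (fun _ _ _ => by simp; ring)

lemma hypForm_apply (P : SI k) (v w : P × k × k) :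
    hypForm P v w = P.form v.1 w.1 + (v.2.1 * w.2.2 - v.2.2 * w.2.1) := rfl

lemma hypForm_isAlt (P : SI k) : (hypForm P).IsAlt := fun v => by
  rw [hypForm_apply, P.isAlt]
  ring

/-- The orthogonal sum of a symplectic space with a hyperbolic plane. -/
def hyp (P : SI k) : SI k where
  carrier := P × k × k
  form := hypForm P
  isAlt := hypForm_isAlt P
  nondegenerate := by
    refine (LinearMap.IsRefl.nondegenerate_iff_separatingLeft (hypForm_isAlt P).isRefl).2 ?_
    rintro ⟨p, a, b⟩ h
    have hp : p = 0 := P.nondegenerate.1 p fun q => by simpa [hypForm_apply] using h (q, 0, 0)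
    have ha : a = 0 := by simpa [hypForm_apply] using h (0, 0, 1)
    have hb : b = 0 := by simpa [hypForm_apply] using h (0, 1, 0)
    rw [hp, ha, hb]
    rfl

lemma finrank_hyp (P : SI k) : Module.finrank k (hyp P) = Module.finrank k P + 2 := by
  change Module.finrank k (P × k × k) = _
  simp

/-- The embedding of a symplectic space into its sum with a hyperbolic plane. -/
def toHyp (P : SI k) : P ⟶ hyp P where
  toLin := LinearMap.inl k P (k × k)
  injective := LinearMap.inl_injective
  isometry := fun x y => by
    change hypForm P (x, 0, 0) (y, 0, 0) = _
    simp [hypForm_apply]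

/-- A linear map preserving symplectic forms is an embedding. -/
def homMk {V W : SI k} (f : V →ₗ[k] W) (h : ∀ x y, W.form (f x) (f y) = V.form x y) : V ⟶ W where
  toLin := f
  injective := (injective_iff_map_eq_zero f).2 fun x hx => V.nondegenerate.1 x fun y => by
    rw [← h, hx, map_zero, LinearMap.zero_apply]
  isometry := h

/-- Extension of an embedding by a hyperbolic pair orthogonal to it. -/
lemma exists_hyp_extension {P V : SI k} (i : P ⟶ V) {x y : V} (hxy : V.form x y = 1)
    (hx : ∀ p, V.form (Hom.toLin i p) x = 0) (hy : ∀ p, V.form (Hom.toLin i p) y = 0) :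
    ∃ j : hyp P ⟶ V, toHyp P ≫ j = i ∧ x ∈ LinearMap.range (Hom.toLin j) := by
  have hx' : ∀ p, V.form x (Hom.toLin i p) = 0 := fun p => by
    rw [← V.isAlt.neg_eq, hx, neg_zero]
  have hy' : ∀ p, V.form y (Hom.toLin i p) = 0 := fun p => by
    rw [← V.isAlt.neg_eq, hy, neg_zero]
  have hyx : V.form y x = -1 := by rw [← V.isAlt.neg_eq, hxy]
  let l : P × k × k →ₗ[k] V := LinearMap.coprod (Hom.toLin i)
    (LinearMap.coprod (LinearMap.toSpanSingleton k V x) (LinearMap.toSpanSingleton k V y))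
  have hl : ∀ v, l v = Hom.toLin i v.1 + (v.2.1 • x + v.2.2 • y) := fun v => rfl
  have hiso : ∀ v w, V.form (l v) (l w) = hypForm P v w := by
    intro v w
    rw [hl, hl, hypForm_apply]
    simp only [map_add, LinearMap.add_apply, map_smul, LinearMap.smul_apply, hx, hy, hx', hy', hxy,
      hyx, V.isAlt.self_eq_zero, Hom.isometry i, smul_eq_mul]
    ring
  refine ⟨homMk (V := hyp P) l hiso, hom_ext fun p => ?_, ⟨((0, 1, 0) : P × k × k), ?_⟩⟩
  · change l (p, 0, 0) = _
    simp [hl]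
  · change l (0, 1, 0) = _
    simp [hl]

/-- Nondegeneracy of `P` represents the pairing with `v` by a vector of `P`, the orthogonal
projection of `v`. -/
lemma exists_orthogonal_decomposition {P V : SI k} (i : P ⟶ V) (v : V) :
    ∃ p : P, ∀ q : P, V.form (Hom.toLin i q) (v - Hom.toLin i p) = 0 := by
  obtain ⟨p, hp⟩ := (P.form.flip.toDual P.nondegenerate.flip).surjective
    ((V.form.flip v).comp (Hom.toLin i))
  refine ⟨p, fun q => ?_⟩
  have h : P.form q p = V.form (Hom.toLin i q) v := LinearMap.congr_fun hp q
  rw [map_sub, Hom.isometry i, h, sub_self]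

/-- A nonzero vector orthogonal to a symplectic subspace is part of a hyperbolic pair orthogonal
to it. -/
lemma exists_hyperbolic_partner {P V : SI k} (i : P ⟶ V) {x : V} (hx0 : x ≠ 0)
    (hx : ∀ p, V.form (Hom.toLin i p) x = 0) :
    ∃ y, V.form x y = 1 ∧ ∀ p, V.form (Hom.toLin i p) y = 0 := by
  obtain ⟨y, hy⟩ : ∃ y, V.form x y ≠ 0 := by
    by_contra! h
    exact hx0 (V.nondegenerate.1 x h)
  obtain ⟨p, hp⟩ := exists_orthogonal_decomposition i y
  have hxp : V.form x (Hom.toLin i p) = 0 := by rw [← V.isAlt.neg_eq, hx, neg_zero]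
  refine ⟨(V.form x y)⁻¹ • (y - Hom.toLin i p), ?_, fun q => ?_⟩
  · rw [map_smul, map_sub, hxp, sub_zero, smul_eq_mul, inv_mul_cancel₀ hy]
  · rw [map_smul, hp, smul_zero]

/-- Only the component of `v` orthogonal to `P` matters; if nonzero, it lies in a hyperbolic plane
orthogonal to `P`. -/
lemma exists_add_vector {P V : SI k} (i : P ⟶ V) (v : V) :
    ∃ (K : SI k) (c : P ⟶ K) (j : K ⟶ V), c ≫ j = i ∧ v ∈ LinearMap.range (Hom.toLin j) ∧
      Module.finrank k K ≤ Module.finrank k P + 2 := by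
  obtain ⟨p, hp⟩ := exists_orthogonal_decomposition i v
  by_cases hv : v - Hom.toLin i p = 0
  · exact ⟨P, 𝟙 P, i, Category.id_comp i, ⟨p, (sub_eq_zero.1 hv).symm⟩, by omega⟩
  obtain ⟨y, hxy, hy⟩ := exists_hyperbolic_partner i hv hp
  obtain ⟨j, hj, x, hx⟩ := exists_hyp_extension i hxy hp hy
  refine ⟨hyp P, toHyp P, j, hj, ⟨x + Hom.toLin (toHyp P) p, ?_⟩, (finrank_hyp P).le⟩
  rw [map_add, hx, ← comp_toLin, hj, sub_add_cancel]

lemma exists_hyp_hom {P V : SI k} (i : P ⟶ V) (h : Module.finrank k P < Module.finrank k V) :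
    ∃ j : hyp P ⟶ V, toHyp P ≫ j = i := by
  obtain ⟨v, hv⟩ : ∃ v, v ∉ LinearMap.range (Hom.toLin i) := by
    by_contra! hv
    have : Module.finrank k V ≤ Module.finrank k P :=
      LinearMap.finrank_le_finrank_of_surjective (f := Hom.toLin i) hv
    omega
  obtain ⟨p, hp⟩ := exists_orthogonal_decomposition i v
  have hv0 : v - Hom.toLin i p ≠ 0 := fun h0 => hv ⟨p, (sub_eq_zero.1 h0).symm⟩
  obtain ⟨y, hxy, hy⟩ := exists_hyperbolic_partner i hv0 hp
  obtain ⟨j, hj, -⟩ := exists_hyp_extension i hxy hp hy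
  exact ⟨j, hj⟩

/-- An embedding whose range contains the range of another one factors it. -/
lemma exists_factor {X K V : SI k} (a : X ⟶ V) (j : K ⟶ V)
    (h : LinearMap.range (Hom.toLin a) ≤ LinearMap.range (Hom.toLin j)) :
    ∃ a' : X ⟶ K, a' ≫ j = a := by
  let e := LinearEquiv.ofInjective (Hom.toLin j) (Hom.injective j)
  let l : X →ₗ[k] K := e.symm.toLinearMap ∘ₗ
    (Hom.toLin a).codRestrict _ fun x => h (LinearMap.mem_range_self _ x)
  have hl : ∀ x, Hom.toLin j (l x) = Hom.toLin a x := fun x =>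
    congrArg Subtype.val (e.apply_symm_apply ⟨Hom.toLin a x, h (LinearMap.mem_range_self _ x)⟩)
  refine ⟨homMk l fun x y => ?_, hom_ext hl⟩
  rw [← Hom.isometry j, hl, hl, Hom.isometry a]

/-- While `P` is smaller than `V`, the same hyperbolic plane can be added to the source of both
embeddings; once `i` is an isomorphism, `l` is its inverse followed by `j`. -/
lemma exists_extension {P V V' : SI k} (i : P ⟶ V) (j : P ⟶ V')
    (h : Module.finrank k V ≤ Module.finrank k V') : ∃ l : V ⟶ V', i ≫ l = j := by
  induction hn : Module.finrank k V - Module.finrank k P using Nat.strong_induction_on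
    generalizing P with
  | _ n ih =>
    have hi := finrank_le i
    by_cases hP : Module.finrank k P = Module.finrank k V
    · have hsurj : LinearMap.range (Hom.toLin i) = ⊤ :=
        LinearMap.range_eq_top.2 ((LinearMap.injective_iff_surjective_of_finrank_eq_finrank hP).1
          (Hom.injective i))
      obtain ⟨l, hl⟩ := exists_factor (𝟙 V) i (by rw [hsurj]; exact le_top)
      refine ⟨l ≫ j, ?_⟩
      rw [← Category.assoc, show i ≫ l = 𝟙 P by
        rw [← cancel_mono i, Category.assoc, hl, Category.comp_id, Category.id_comp],
        Category.id_comp]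
    · obtain ⟨i', hi'⟩ := exists_hyp_hom i (by omega)
      obtain ⟨j', hj'⟩ := exists_hyp_hom j (by omega)
      have hf := finrank_hyp P
      obtain ⟨l, hl⟩ := ih _ (by omega) i' j' rfl
      exact ⟨l, by rw [← hi', Category.assoc, hl, hj']⟩

lemma even_finrank_iff {P V : SI k} (i : P ⟶ V) :
    Even (Module.finrank k P) ↔ Even (Module.finrank k V) := by
  induction hn : Module.finrank k V - Module.finrank k P using Nat.strong_induction_on
    generalizing P with
  | _ n ih =>
    have hi := finrank_le i
    by_cases hP : Module.finrank k P = Module.finrank k V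
    · rw [hP]
    · obtain ⟨i', hi'⟩ := exists_hyp_hom i (by omega)
      have hf := finrank_hyp P
      rw [← ih _ (by omega) i' rfl, hf, Nat.even_add]
      simp

lemma finrank_eq (V : SI k) : Module.finrank k V = 2 * degree V := by
  have h : Even (Module.finrank k V) := (even_finrank_iff (fromZero V)).1 (by simp [finrank_zero])
  exact (Nat.two_mul_div_two_of_even h).symm

/-! ### Symplectic hulls -/

lemma exists_add_list {P V : SI k} (i : P ⟶ V) (s : List V) :
    ∃ (K : SI k) (c : P ⟶ K) (j : K ⟶ V), c ≫ j = i ∧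
      (∀ v ∈ s, v ∈ LinearMap.range (Hom.toLin j)) ∧
      Module.finrank k K ≤ Module.finrank k P + 2 * s.length := by
  induction s with
  | nil => exact ⟨P, 𝟙 P, i, Category.id_comp i, by simp, by simp⟩
  | cons v s ih =>
    obtain ⟨K, c, j, hj, hs, hK⟩ := ih
    obtain ⟨L, d, l, hl, hv, hL⟩ := exists_add_vector j v
    refine ⟨L, c ≫ d, l, by rw [Category.assoc, hl, hj], ?_, ?_⟩
    · rintro w (_ | ⟨_, hw⟩)
      · exact hv
      · obtain ⟨x, rfl⟩ := hs w hw
        exact ⟨Hom.toLin d x, by rw [← comp_toLin, hl]⟩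
    · rw [List.length_cons]
      omega

/-- To `V₁` one adjoins the images of a basis of a complement of `Z` in `V₀`. These are `2 * (deg V₀
- deg Z)` vectors, each costing at most one hyperbolic plane, that is, degree one. -/
lemma exists_hull {Z V₀ V₁ V : SI k} (z₀ : Z ⟶ V₀) (z₁ : Z ⟶ V₁) (a : V₀ ⟶ V) (b : V₁ ⟶ V)
    (h : z₀ ≫ a = z₁ ≫ b) : ∃ (K : SI k) (j : K ⟶ V) (a' : V₀ ⟶ K) (b' : V₁ ⟶ K),
      a' ≫ j = a ∧ b' ≫ j = b ∧
      degree K ≤ degree V₁ + 2 * (degree V₀ - degree Z) + 1 := by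
  obtain ⟨Y, hY⟩ := (LinearMap.range (Hom.toLin z₀)).exists_isCompl
  let bas := Module.finBasis k Y
  obtain ⟨K, c, j, hj, hs, hK⟩ := exists_add_list b
    (List.ofFn fun n => Hom.toLin a (bas n : V₀))
  have hrange : LinearMap.range (Hom.toLin a) ≤ LinearMap.range (Hom.toLin j) := by
    rw [← Submodule.map_top, ← hY.sup_eq_top, Submodule.map_sup, sup_le_iff]
    constructor
    · rintro _ ⟨_, ⟨z, rfl⟩, rfl⟩
      rw [← comp_toLin, h, ← hj]
      exact ⟨_, rfl⟩
    · have hYs : Submodule.span k (Set.range fun n => (bas n : V₀)) = Y := by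
        have := congrArg (Submodule.map Y.subtype) bas.span_eq
        rwa [Submodule.map_span, ← Set.range_comp, Submodule.map_subtype_top] at this
      rw [← hYs, Submodule.map_span, Submodule.span_le]
      rintro _ ⟨_, ⟨n, rfl⟩, rfl⟩
      exact hs _ (List.mem_ofFn.2 ⟨n, rfl⟩)
  obtain ⟨a', ha'⟩ := exists_factor a j hrange
  refine ⟨K, j, a', c, ha', hj, ?_⟩
  have h1 := Submodule.finrank_add_eq_of_isCompl hY
  rw [LinearMap.finrank_range_of_inj (Hom.injective z₀)] at h1
  rw [List.length_ofFn] at hK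
  have e0 := finrank_eq Z
  have e1 := finrank_eq V₀
  have e2 := finrank_eq V₁
  have e3 := finrank_eq K
  omega

lemma exists_degree_eq (n : ℕ) : ∃ V : SI k, degree V = n := by
  induction n with
  | zero => exact ⟨zero k, by simp [degree, finrank_zero]⟩
  | succ n ih =>
    obtain ⟨V, rfl⟩ := ih
    refine ⟨hyp V, ?_⟩
    have h1 := finrank_hyp V
    have h2 := finrank_eq V
    have h3 := finrank_eq (hyp V)
    omega

theorem stabilityCategory [Finite k] : CatModule.StabilityCategory (degree (k := k)) where
  finite_hom := finite_hom
  mono := mono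
  deg_le f := Nat.div_le_div_right (finrank_le f)
  exists_deg_eq := exists_degree_eq
  exists_initial := ⟨zero k, by simp [degree, finrank_zero], fun X => ⟨inferInstance⟩⟩
  extend {P V V'} i j h := exists_extension i j (by rw [finrank_eq V, finrank_eq V']; omega)
  hull := exists_hull

end SI

namespace VICU

/-! ### Oriented vector spaces with complemented injections form a stability category -/

/-! ### Top exterior powers and determinants -/

section TopExteriorPower

variable {k : Type u} [Field k] {V W : Type u} [AddCommGroup V] [Module k V] [AddCommGroup W]
  [Module k W]

/-- On the top exterior power, every decomposable vector is a multiple of the one of a basis. -/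
lemma ιMulti_eq_det_smul {n : ℕ} (b : Module.Basis (Fin n) k V) (v : Fin n → V) :
    ExteriorAlgebra.ιMulti k n v = b.det v • ExteriorAlgebra.ιMulti k n b := by
  suffices h : ExteriorAlgebra.ιMulti k n =
      (LinearMap.toSpanSingleton k _ (ExteriorAlgebra.ιMulti k n b)).compAlternatingMap b.det from
    DFunLike.congr_fun h v
  refine b.ext_alternating fun σ hσ => ?_
  let τ : Equiv.Perm (Fin n) := Equiv.ofBijective σ (Finite.injective_iff_bijective.1 hσ)
  change ExteriorAlgebra.ιMulti k n (b ∘ τ) = b.det (b ∘ τ) • ExteriorAlgebra.ιMulti k n b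
  rw [AlternatingMap.map_perm, AlternatingMap.map_perm, b.det_self]
  rcases Int.units_eq_one_or (Equiv.Perm.sign τ) with h | h <;> simp [h]

lemma span_ιMulti_basis {n : ℕ} (b : Module.Basis (Fin n) k V) :
    Submodule.span k {ExteriorAlgebra.ιMulti k n b} = ⋀[k]^n V := by
  rw [← ExteriorAlgebra.ιMulti_span_fixedDegree]
  refine le_antisymm (Submodule.span_mono ?_) (Submodule.span_le.2 ?_)
  · rintro _ rfl
    exact ⟨b, rfl⟩
  · rintro _ ⟨v, rfl⟩
    exact SetLike.mem_coe.2
      (Submodule.mem_span_singleton.2 ⟨b.det v, (ιMulti_eq_det_smul b v).symm⟩)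

/-- An endomorphism acts on the top exterior power by its determinant. -/
lemma map_eq_det_smul [FiniteDimensional k V] (f : V →ₗ[k] V) {ω : ExteriorAlgebra k V}
    (hω : ω ∈ ⋀[k]^(Module.finrank k V) V) :
    ExteriorAlgebra.map f ω = LinearMap.det f • ω := by
  let b := Module.finBasis k V
  rw [← span_ιMulti_basis b] at hω
  obtain ⟨c, rfl⟩ := Submodule.mem_span_singleton.1 hω
  rw [map_smul, ExteriorAlgebra.map_apply_ιMulti, ιMulti_eq_det_smul b, b.det_comp, b.det_self,
    mul_one, smul_comm]

lemma map_mem_exteriorPower {n : ℕ} (f : V →ₗ[k] W) {ω : ExteriorAlgebra k V} (hω : ω ∈ ⋀[k]^n V) :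
    ExteriorAlgebra.map f ω ∈ ⋀[k]^n W := by
  rw [← ExteriorAlgebra.ιMulti_span_fixedDegree] at hω ⊢
  refine (Submodule.span_le.2 ?_ :
    _ ≤ (Submodule.span k _).comap (ExteriorAlgebra.map f).toLinearMap) hω
  rintro _ ⟨v, rfl⟩
  exact Submodule.subset_span ⟨f ∘ v, (ExteriorAlgebra.map_apply_ιMulti f v).symm⟩

lemma nonempty_uOrientation [FiniteDimensional k V] (U : Subgroup kˣ) :
    Nonempty (UOrientation k U V) :=
  ⟨⟨_, _, span_ιMulti_basis (k := k) (Module.finBasis k V), rfl⟩⟩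

/-- An isomorphism carries generators of the top exterior power to each other up to a unit. -/
lemma exists_map_eq_smul [FiniteDimensional k V] [FiniteDimensional k W] (f : V →ₗ[k] W)
    (hf : Function.Injective f) (h : Module.finrank k V = Module.finrank k W)
    {ω : ExteriorAlgebra k V} {ω' : ExteriorAlgebra k W}
    (hω : Submodule.span k {ω} = ⋀[k]^(Module.finrank k V) V)
    (hω' : Submodule.span k {ω'} = ⋀[k]^(Module.finrank k W) W) :
    ∃ c : k, c ≠ 0 ∧ ExteriorAlgebra.map f ω = c • ω' := by
  have h1 : ω ∈ ⋀[k]^(Module.finrank k W) V := by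
    rw [← h, ← hω]
    exact Submodule.mem_span_singleton_self _
  have h2 := map_mem_exteriorPower f h1
  rw [← hω'] at h2
  obtain ⟨c, hc⟩ := Submodule.mem_span_singleton.1 h2
  -- If `c = 0`, injectivity forces both generators to vanish, and any nonzero scalar serves.
  by_cases h0 : c = 0
  · refine ⟨1, one_ne_zero, ?_⟩
    rw [h0, zero_smul] at hc
    have hω0 : ω = 0 := ExteriorAlgebra.map_injective_field
      (LinearMap.ker_eq_bot.2 hf) (hc.symm.trans (map_zero _).symm)
    have e : V ≃ₗ[k] W := LinearEquiv.ofFinrankEq V W h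
    have hV : ∀ x ∈ ⋀[k]^(Module.finrank k V) V, x = 0 := fun x hx => by
      rw [← hω, hω0] at hx
      simpa using hx
    have h3 : ω' ∈ ⋀[k]^(Module.finrank k W) W := by
      rw [← hω']
      exact Submodule.mem_span_singleton_self _
    rw [← h] at h3
    have h4 := hV _ (map_mem_exteriorPower e.symm.toLinearMap h3)
    have h5 : ω' = 0 := ExteriorAlgebra.map_injective_field
      (LinearMap.ker_eq_bot.2 e.symm.injective) (h4.trans (map_zero _).symm)
    rw [hω0, h5, map_zero, smul_zero]
  · exact ⟨c, h0, hc.symm⟩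

end TopExteriorPower

/-! ### Complements and general position -/

section LinearAlgebra

variable {k : Type u} [Field k] {P V W : Type u} [AddCommGroup P] [Module k P] [AddCommGroup V]
  [Module k V] [AddCommGroup W] [Module k W] [FiniteDimensional k V] [FiniteDimensional k W]

/-- Extension of complemented injections. -/
lemma exists_linear_extension {i : P →ₗ[k] V} {j : P →ₗ[k] W} (hi : Function.Injective i)
    (hj : Function.Injective j) {C : Submodule k V} {D : Submodule k W}
    (hC : IsCompl (LinearMap.range i) C) (hD : IsCompl (LinearMap.range j) D)
    (h : Module.finrank k V ≤ Module.finrank k W) :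
    ∃ (l : V →ₗ[k] W) (E : Submodule k W), Function.Injective l ∧ IsCompl (LinearMap.range l) E ∧
      l ∘ₗ i = j ∧ E ⊔ C.map l = D := by
  have h1 := Submodule.finrank_add_eq_of_isCompl hC
  have h2 := Submodule.finrank_add_eq_of_isCompl hD
  rw [LinearMap.finrank_range_of_inj hi] at h1
  rw [LinearMap.finrank_range_of_inj hj] at h2
  obtain ⟨e, he⟩ := (finrank_le_iff_exists_linearMap (R := k) (M := C)
    (M' := D)).1 (by omega)
  obtain ⟨F, hF⟩ := (LinearMap.range e).exists_isCompl
  let r := LinearEquiv.ofInjective i hi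
  -- `l` is `j ∘ i⁻¹` on the range of `i` and embeds `C` into `D`; what `D` has left over, `F`,
  -- becomes the complement of the range.
  let l : V →ₗ[k] W := LinearMap.ofIsCompl hC (j ∘ₗ r.symm.toLinearMap) (D.subtype ∘ₗ e)
  have hli : ∀ p, l (i p) = j p := fun p => by
    have h3 := LinearMap.ofIsCompl_apply_left hC (φ := j ∘ₗ r.symm.toLinearMap)
      (ψ := D.subtype ∘ₗ e) (r p)
    rw [LinearMap.comp_apply] at h3
    refine h3.trans (congrArg j (r.symm_apply_apply p))
  have hlc : ∀ c : C, l c = (e c : W) := fun c => LinearMap.ofIsCompl_apply_right hC c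
  have hdecomp : ∀ x, ∃ (p : P) (c : C), x = i p + c := fun x => by
    obtain ⟨_, ⟨p, rfl⟩, c, hc, rfl⟩ := Submodule.mem_sup.1
      (hC.sup_eq_top ▸ Submodule.mem_top : x ∈ _)
    exact ⟨p, ⟨c, hc⟩, rfl⟩
  have hCl : C.map l = (LinearMap.range e).map D.subtype := by
    ext w
    constructor
    · rintro ⟨c, hc, rfl⟩
      exact ⟨e ⟨c, hc⟩, ⟨_, rfl⟩, (hlc ⟨c, hc⟩).symm⟩
    · rintro ⟨_, ⟨c, rfl⟩, rfl⟩
      exact ⟨c, c.2, hlc c⟩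
  have hsup : F.map D.subtype ⊔ C.map l = D := by
    rw [hCl, ← Submodule.map_sup, sup_comm, hF.sup_eq_top, Submodule.map_subtype_top]
  have hzero : ∀ (p : P) (d : D), j p + d = 0 → p = 0 ∧ d = 0 := fun p d hpd => by
    have h0 : (d : W) = 0 := Submodule.disjoint_def.1 hD.disjoint d
      ⟨-p, by rw [map_neg, neg_eq_of_add_eq_zero_right hpd]⟩ d.2
    rw [h0, add_zero] at hpd
    exact ⟨hj (hpd.trans (map_zero j).symm), Subtype.ext h0⟩
  refine ⟨l, F.map D.subtype, (injective_iff_map_eq_zero l).2 fun x hx => ?_, ⟨?_, ?_⟩,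
    LinearMap.ext hli, hsup⟩
  · obtain ⟨p, c, rfl⟩ := hdecomp x
    rw [map_add, hli, hlc] at hx
    obtain ⟨rfl, hc⟩ := hzero p (e c) hx
    rw [he (hc.trans (map_zero e).symm)]
    simp
  · refine Submodule.disjoint_def.2 ?_
    rintro _ ⟨x, rfl⟩ ⟨d, hd, hdx⟩
    obtain ⟨p, c, rfl⟩ := hdecomp x
    rw [map_add, hli, hlc] at hdx ⊢
    obtain ⟨rfl, hc⟩ := hzero p (e c - d) (by
      rw [AddSubgroupClass.coe_sub, ← add_sub_assoc, ← hdx]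
      exact sub_self _)
    rw [Submodule.disjoint_def.1 hF.disjoint (e c) ⟨c, rfl⟩ (by rwa [sub_eq_zero.1 hc])]
    simp
  · rw [codisjoint_iff, eq_top_iff, ← hD.sup_eq_top, sup_le_iff]
    constructor
    · rintro _ ⟨p, rfl⟩
      exact Submodule.mem_sup_left ⟨i p, hli p⟩
    · refine hsup.symm.le.trans ?_
      exact sup_le le_sup_right (LinearMap.map_le_range.trans le_sup_left)

/-- A subspace of prescribed dimension meeting another one trivially. -/
lemma exists_le_disjoint_finrank_eq (Q S : Submodule k V) {n : ℕ}
    (h : n + Module.finrank k ↥(Q ⊓ S) ≤ Module.finrank k Q) :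
    ∃ L ≤ Q, Disjoint S L ∧ Module.finrank k L = n := by
  obtain ⟨F, hF⟩ := ((Q ⊓ S).comap Q.subtype).exists_isCompl
  have h1 := Submodule.finrank_add_eq_of_isCompl hF
  have h2 : Module.finrank k ((Q ⊓ S).comap Q.subtype) = Module.finrank k ↥(Q ⊓ S) :=
    (Submodule.comapSubtypeEquivOfLe inf_le_left).finrank_eq
  obtain ⟨e, he⟩ := (finrank_le_iff_exists_linearMap (R := k) (M := Fin n → k)
    (M' := F)).1 (by rw [Module.finrank_fin_fun]; omega)
  have hinj : Function.Injective (Q.subtype ∘ₗ F.subtype ∘ₗ e) :=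
    Q.subtype_injective.comp (F.subtype_injective.comp he)
  refine ⟨LinearMap.range (Q.subtype ∘ₗ F.subtype ∘ₗ e), ?_, Submodule.disjoint_def.2 ?_, ?_⟩
  · rintro _ ⟨x, rfl⟩
    exact (e x : Q).2
  · rintro _ hx ⟨x, rfl⟩
    have := Submodule.disjoint_def.1 hF.disjoint (e x : Q) ⟨(e x : Q).2, hx⟩ (e x).2
    exact congrArg Q.subtype this
  · rw [LinearMap.finrank_range_of_inj hinj, Module.finrank_fin_fun]

end LinearAlgebra

/-! ### Morphisms, hulls and extensions in `VIC^U(k)` -/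

variable {k : Type u} [Field k] {U : Subgroup kˣ}

lemma comp_compl {V W X : VICU k U} (f : V ⟶ W) (g : W ⟶ X) :
    Hom.compl (f ≫ g) = Hom.compl g ⊔ (Hom.compl f).map (Hom.toLin g) := rfl

lemma finrank_le {V W : VICU k U} (f : V ⟶ W) : Module.finrank k V ≤ Module.finrank k W :=
  LinearMap.finrank_le_finrank_of_injective (Hom.injective f)

lemma finrank_add_compl {V W : VICU k U} (f : V ⟶ W) :
    Module.finrank k V + Module.finrank k (Hom.compl f) = Module.finrank k W := by
  rw [← Submodule.finrank_add_eq_of_isCompl (Hom.isCompl f),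
    LinearMap.finrank_range_of_inj (Hom.injective f)]

/-- This recovers the complement of `f` from `f ≫ g`, which is what makes `g` a monomorphism. -/
lemma comap_compl_comp {V W X : VICU k U} (f : V ⟶ W) (g : W ⟶ X) :
    (Hom.compl (f ≫ g)).comap (Hom.toLin g) = Hom.compl f := by
  rw [comp_compl]
  refine le_antisymm (fun x hx => ?_) fun x hx =>
    Submodule.mem_sup_right (Submodule.mem_map_of_mem hx)
  obtain ⟨c, hc, _, ⟨d, hd, rfl⟩, h⟩ := Submodule.mem_sup.1 (Submodule.mem_comap.1 hx)
  have h0 : c = 0 := by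
    refine (Submodule.disjoint_def.1 (Hom.isCompl g).disjoint) c ⟨x - d, ?_⟩ hc
    rw [map_sub, ← h, add_sub_cancel_right]
  rw [h0, zero_add] at h
  rwa [← Hom.injective g h]

instance mono {V W : VICU k U} (f : V ⟶ W) : Mono f := by
  refine ⟨fun g h e => Hom.ext ?_ ?_⟩
  · ext x
    exact Hom.injective f (congrArg (fun l => Hom.toLin l x) e)
  · rw [← comap_compl_comp g f, e, comap_compl_comp]

lemma finite_hom [Finite k] (V W : VICU k U) : Finite (V ⟶ W) := by
  have := Module.finite_of_finite k (M := V)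
  have := Module.finite_of_finite k (M := W)
  have : Finite (Submodule k W) := Finite.of_injective (fun S => (S : Set W)) SetLike.coe_injective
  exact Finite.of_injective
    (fun f : V ⟶ W => ((Hom.toLin f : V → W), Hom.compl f)) fun f g h =>
      Hom.ext (DFunLike.coe_injective (Prod.ext_iff.1 h).1) (Prod.ext_iff.1 h).2

/-- A vector space with some orientation. -/
noncomputable def ofSpace (U : Subgroup kˣ) (V : Type u) [AddCommGroup V] [Module k V]
    [FiniteDimensional k V] : VICU k U where
  carrier := V
  orientation _ := (nonempty_uOrientation U).some

/-- The zero space. -/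
noncomputable def zero (U : Subgroup kˣ) : VICU k U := ofSpace U PUnit.{u + 1}

lemma finrank_zero : Module.finrank k (zero U) = 0 :=
  Module.finrank_zero_of_subsingleton (M := PUnit.{u + 1})

/-- The morphism from the zero space. -/
noncomputable def fromZero (V : VICU k U) : zero U ⟶ V where
  toLin := 0
  compl := ⊤
  injective := fun x y _ => Subsingleton.elim (α := PUnit) x y
  isCompl := by rw [LinearMap.range_zero]; exact isCompl_bot_top
  map_orientation := fun _ h => absurd finrank_zero h

noncomputable instance (V : VICU k U) : Unique (zero U ⟶ V) where
  default := fromZero V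
  uniq f := by
    have h : Hom.toLin f = 0 := by
      ext x
      rw [show x = 0 from Subsingleton.elim (α := PUnit) _ _, map_zero, map_zero]
    refine Hom.ext h ?_
    have := (Hom.isCompl f).sup_eq_top
    rw [h, LinearMap.range_zero, bot_sup_eq] at this
    exact this

/-- Factorization of a morphism through another one. -/
lemma exists_factor {X K V : VICU k U} (a : X ⟶ V) (j : K ⟶ V)
    (h : LinearMap.range (Hom.toLin a) ≤ LinearMap.range (Hom.toLin j))
    (h' : Hom.compl j ≤ Hom.compl a) (hlt : Module.finrank k X < Module.finrank k K) :
    ∃ a' : X ⟶ K, a' ≫ j = a := by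
  let e := LinearEquiv.ofInjective (Hom.toLin j) (Hom.injective j)
  let l : X →ₗ[k] K := e.symm.toLinearMap ∘ₗ
    (Hom.toLin a).codRestrict _ fun x => h (LinearMap.mem_range_self _ x)
  have hl : ∀ x, Hom.toLin j (l x) = Hom.toLin a x := fun x =>
    congrArg Subtype.val (e.apply_symm_apply ⟨Hom.toLin a x, h (LinearMap.mem_range_self _ x)⟩)
  have hcompl : IsCompl (LinearMap.range l) ((Hom.compl a).comap (Hom.toLin j)) := by
    refine ⟨Submodule.disjoint_def.2 ?_, codisjoint_iff.2 (eq_top_iff.2 fun x _ => ?_)⟩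
    · rintro _ ⟨x, rfl⟩ hx
      have hx' : Hom.toLin a x ∈ Hom.compl a := by
        rw [← hl]
        exact hx
      have := (Submodule.disjoint_def.1 (Hom.isCompl a).disjoint) _ ⟨x, rfl⟩ hx'
      refine Hom.injective j ?_
      rw [hl, this, map_zero]
    · obtain ⟨_, ⟨y, rfl⟩, q, hq, hyq⟩ := Submodule.mem_sup.1
        ((Hom.isCompl a).sup_eq_top ▸ Submodule.mem_top : Hom.toLin j x ∈ _)
      refine Submodule.mem_sup.2 ⟨l y, ⟨y, rfl⟩, x - l y, ?_, by abel⟩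
      rw [Submodule.mem_comap, map_sub, hl, ← hyq, add_sub_cancel_left]
      exact hq
  -- The strict inequality of dimensions makes the orientation condition vacuous.
  refine ⟨⟨l, (Hom.compl a).comap (Hom.toLin j), fun x y hxy => Hom.injective a ?_, hcompl,
    fun heq => absurd heq hlt.ne⟩, Hom.ext (LinearMap.ext hl) (le_antisymm ?_ fun q hq => ?_)⟩
  · rw [← hl, hxy, hl]
  · exact sup_le h' (Submodule.map_comap_le _ _)
  · obtain ⟨_, ⟨y, rfl⟩, c, hc, hyc⟩ := Submodule.mem_sup.1
      ((Hom.isCompl j).sup_eq_top ▸ Submodule.mem_top : q ∈ _)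
    refine Submodule.mem_sup.2 ⟨c, hc, Hom.toLin j y, ⟨y, ?_, rfl⟩, by rw [add_comm, hyc]⟩
    change Hom.toLin j y ∈ Hom.compl a
    rw [eq_sub_of_add_eq hyc]
    exact sub_mem hq (h' hc)

lemma exists_degree_eq (n : ℕ) : ∃ V : VICU k U, degree V = n :=
  ⟨ofSpace U (Fin n → k), Module.finrank_fin_fun k⟩

lemma finrank_sup_le {V₀ V₁ V : VICU k U} {Z : VICU k U} (z₀ : Z ⟶ V₀) (z₁ : Z ⟶ V₁)
    (a : V₀ ⟶ V) (b : V₁ ⟶ V) (h : z₀ ≫ a = z₁ ≫ b) :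
    Module.finrank k ↥(LinearMap.range (Hom.toLin a) ⊔ LinearMap.range (Hom.toLin b)) +
      Module.finrank k Z ≤ Module.finrank k V₀ + Module.finrank k V₁ := by
  have h1 := Submodule.finrank_sup_add_finrank_inf_eq (LinearMap.range (Hom.toLin a))
    (LinearMap.range (Hom.toLin b))
  rw [LinearMap.finrank_range_of_inj (Hom.injective a),
    LinearMap.finrank_range_of_inj (Hom.injective b)] at h1
  have h2 : LinearMap.range (Hom.toLin (z₀ ≫ a)) ≤
      LinearMap.range (Hom.toLin a) ⊓ LinearMap.range (Hom.toLin b) := by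
    refine le_inf ?_ ?_
    · exact LinearMap.range_comp_le_range _ _
    · rw [h]
      exact LinearMap.range_comp_le_range _ _
  have h3 := Submodule.finrank_mono h2
  rw [LinearMap.finrank_range_of_inj (Hom.injective (z₀ ≫ a))] at h3
  omega

/-- Dual to `finrank_sup_le`: both complements lie in that of the common composite, of dimension
`dim V - dim Z`. -/
lemma finrank_le_compl_inf {V₀ V₁ V : VICU k U} {Z : VICU k U} (z₀ : Z ⟶ V₀) (z₁ : Z ⟶ V₁)
    (a : V₀ ⟶ V) (b : V₁ ⟶ V) (h : z₀ ≫ a = z₁ ≫ b) :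
    Module.finrank k V + Module.finrank k Z ≤ Module.finrank k V₀ + Module.finrank k V₁ +
      Module.finrank k ↥(Hom.compl a ⊓ Hom.compl b) := by
  have h1 := Submodule.finrank_sup_add_finrank_inf_eq (Hom.compl a) (Hom.compl b)
  have h2 : Hom.compl a ⊔ Hom.compl b ≤ Hom.compl (z₀ ≫ a) := by
    refine sup_le le_sup_left ?_
    rw [h]
    exact le_sup_left
  have h3 := Submodule.finrank_mono h2
  have h4 := finrank_add_compl (z₀ ≫ a)
  have h5 := finrank_add_compl a
  have h6 := finrank_add_compl b
  omega

lemma exists_hull {Z V₀ V₁ V : VICU k U} (z₀ : Z ⟶ V₀) (z₁ : Z ⟶ V₁) (a : V₀ ⟶ V) (b : V₁ ⟶ V)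
    (h : z₀ ≫ a = z₁ ≫ b) : ∃ (K : VICU k U) (j : K ⟶ V) (a' : V₀ ⟶ K) (b' : V₁ ⟶ K),
      a' ≫ j = a ∧ b' ≫ j = b ∧
      degree K ≤ degree V₁ + 2 * (degree V₀ - degree Z) + 1 := by
  by_cases hN : degree V ≤ degree V₁ + 2 * (degree V₀ - degree Z) + 1
  · exact ⟨V, 𝟙 V, a, b, Category.comp_id a, Category.comp_id b, hN⟩
  simp only [degree] at hN ⊢
  have hz := finrank_le z₀
  have hz₁ := finrank_le z₁
  have hS := finrank_sup_le z₀ z₁ a b h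
  have hQ := finrank_le_compl_inf z₀ z₁ a b h
  set S := LinearMap.range (Hom.toLin a) ⊔ LinearMap.range (Hom.toLin b) with hSdef
  set Q := Hom.compl a ⊓ Hom.compl b with hQdef
  have hQS : Module.finrank k ↥(Q ⊓ S) + Module.finrank k V₁ ≤ Module.finrank k S := by
    have h1 := Submodule.finrank_sup_add_finrank_inf_eq (Q ⊓ S) (LinearMap.range (Hom.toLin b))
    have h2 : (Q ⊓ S) ⊓ LinearMap.range (Hom.toLin b) = ⊥ :=
      ((Hom.isCompl b).symm.disjoint.mono_left (inf_le_left.trans inf_le_right)).eq_bot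
    have h3 := Submodule.finrank_mono (sup_le inf_le_right le_sup_right :
      (Q ⊓ S) ⊔ LinearMap.range (Hom.toLin b) ≤ S)
    rw [h2, finrank_bot, LinearMap.finrank_range_of_inj (Hom.injective b)] at h1
    omega
  -- `L` is to be the complement of `K`: inside both given complements and disjoint from the sum of
  -- the ranges. Since `Q ⊓ S` has dimension at most `dim V₀ - dim Z`, there is room for `L` of
  -- codimension `dim V₁ + 2 * (dim V₀ - dim Z) + 1`, which exceeds both `dim V₀` and `dim V₁`.
  obtain ⟨L, hLQ, hLS, hL⟩ := exists_le_disjoint_finrank_eq Q S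
    (n := Module.finrank k V - (Module.finrank k V₁ +
      2 * (Module.finrank k V₀ - Module.finrank k Z) + 1)) (by omega)
  obtain ⟨T, hST, hT⟩ := hLS.exists_isCompl
  have hTL := Submodule.finrank_add_eq_of_isCompl hT
  let K : VICU k U := ofSpace U T
  have hK : Module.finrank k K = Module.finrank k T := rfl
  let j : K ⟶ V := ⟨T.subtype, L, T.subtype_injective,
    (Submodule.range_subtype T).symm ▸ hT, fun heq => by omega⟩
  have hj : LinearMap.range (Hom.toLin j) = T := Submodule.range_subtype T
  obtain ⟨a', ha⟩ := exists_factor a j (hj ▸ le_sup_left.trans hST) (hLQ.trans inf_le_left)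
    (by omega)
  obtain ⟨b', hb⟩ := exists_factor b j (hj ▸ le_sup_right.trans hST) (hLQ.trans inf_le_right)
    (by omega)
  exact ⟨K, j, a', b', ha, hb, by omega⟩

lemma exists_extension {P V V' : VICU k U} (i : P ⟶ V) (j : P ⟶ V') (h : degree V ≤ degree V') :
    ∃ l : V ⟶ V', i ≫ l = j := by
  obtain ⟨l, E, hl, hE, hli, hEC⟩ := exists_linear_extension (Hom.injective i) (Hom.injective j)
    (Hom.isCompl i) (Hom.isCompl j) h
  by_cases hlt : Module.finrank k V < Module.finrank k V'
  · exact ⟨⟨l, E, hl, hE, fun heq => absurd heq hlt.ne⟩, Hom.ext hli hEC⟩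
  have heq : Module.finrank k V = Module.finrank k V' := le_antisymm h (not_lt.1 hlt)
  have hi := finrank_add_compl i
  have hj := finrank_add_compl j
  -- Here `i` and `j` are isomorphisms, so `l` is forced and inherits compatibility with the
  -- orientations from them.
  by_cases hP : Module.finrank k P = Module.finrank k V
  · refine ⟨⟨l, E, hl, hE, fun _ hV hV' => ?_⟩, Hom.ext hli hEC⟩
    rw [← Hom.map_orientation i hP (hP ▸ hV) hV, ← Hom.map_orientation j (hP.trans heq) (hP ▸ hV) hV',
      Set.image_image, ← hli]
    refine Set.image_congr fun x _ => ?_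
    rw [← ExteriorAlgebra.map_comp_map]
    rfl
  have hV : Module.finrank k V ≠ 0 := by
    have := finrank_le i
    omega
  have hV' : Module.finrank k V' ≠ 0 := heq ▸ hV
  obtain ⟨ω, hω, hωU⟩ := (V.orientation hV).exists_generator
  obtain ⟨ω', hω', hωU'⟩ := (V'.orientation hV').exists_generator
  obtain ⟨c, hc, hlω⟩ := exists_map_eq_smul l hl heq hω hω'
  obtain ⟨d, hd, hd0⟩ : ∃ d ∈ Hom.compl j, d ≠ 0 := by
    refine (Submodule.ne_bot_iff _).1 fun h0 => ?_
    rw [h0, finrank_bot] at hj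
    have := finrank_le i
    omega
  obtain ⟨φ, hφd, hφ⟩ := Submodule.exists_dual_map_eq_bot_of_notMem
    (p := LinearMap.range (Hom.toLin j)) (x := d)
    (fun hdj => hd0 (Submodule.disjoint_def.1 (Hom.isCompl j).disjoint d hdj hd)) inferInstance
  have hφj : ∀ p, φ (Hom.toLin j p) = 0 := fun p =>
    (Submodule.mem_bot k).1 (hφ ▸ Submodule.mem_map_of_mem ⟨p, rfl⟩)
  -- `g` fixes the range of `j` pointwise, preserves its complement and scales `d` by `c⁻¹`. Its
  -- determinant `c⁻¹` cancels the factor `c` by which `l` misses the orientation.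
  let g : V' →ₗ[k] V' := LinearMap.transvection φ (((c⁻¹ - 1) * (φ d)⁻¹) • d)
  have hgx : ∀ x, g x = x + φ x • ((c⁻¹ - 1) * (φ d)⁻¹) • d := fun x => rfl
  have hg : LinearMap.det g = c⁻¹ := by
    rw [LinearMap.transvection.det, map_smul, smul_eq_mul, mul_assoc, inv_mul_cancel₀ hφd]
    ring
  have hginj : Function.Injective g := by
    have hu : IsUnit (LinearMap.det g) := by
      rw [hg]
      exact (inv_ne_zero hc).isUnit
    exact ((LinearMap.isUnit_iff_isUnit_det g).2 hu |> (Module.End.isUnit_iff g).1).injective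
  have hinj : Function.Injective (g ∘ₗ l) := hginj.comp hl
  have htop : LinearMap.range (g ∘ₗ l) = ⊤ := LinearMap.range_eq_top.2
    ((LinearMap.injective_iff_surjective_of_finrank_eq_finrank heq).1 hinj)
  let m : V ⟶ V' := ⟨g ∘ₗ l, ⊥, hinj, by rw [htop]; exact isCompl_top_bot, fun _ _ _ => by
    rw [hωU, hωU']
    have hω'mem : ω' ∈ ⋀[k]^(Module.finrank k V') V' := by
      rw [← hω']
      exact Submodule.mem_span_singleton_self _
    have hgl : ExteriorAlgebra.map (g ∘ₗ l) ω = ω' := by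
      rw [← ExteriorAlgebra.map_comp_map, AlgHom.comp_apply, hlω, map_smul,
        map_eq_det_smul g hω'mem, hg, smul_smul, mul_inv_cancel₀ hc, one_smul]
    ext x
    constructor
    · rintro ⟨_, ⟨u, hu, rfl⟩, rfl⟩
      exact ⟨u, hu, by rw [map_smul, hgl]⟩
    · rintro ⟨u, hu, rfl⟩
      exact ⟨_, ⟨u, hu, rfl⟩, by rw [map_smul, hgl]⟩⟩
  refine ⟨m, Hom.ext (LinearMap.ext fun p => ?_) ?_⟩
  · change g (l (Hom.toLin i p)) = _
    rw [show l (Hom.toLin i p) = Hom.toLin j p from LinearMap.congr_fun hli p, hgx, hφj, zero_smul,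
      add_zero]
  · refine Submodule.eq_of_le_of_finrank_eq ?_ ?_
    · rw [comp_compl]
      refine sup_le bot_le ?_
      rintro _ ⟨x, hx, rfl⟩
      change g (l x) ∈ Hom.compl j
      rw [hgx]
      refine add_mem ?_ (Submodule.smul_mem _ _ (Submodule.smul_mem _ _ hd))
      rw [← hEC]
      exact Submodule.mem_sup_right ⟨x, hx, rfl⟩
    · have := finrank_add_compl (i ≫ m)
      omega

theorem stabilityCategory [Finite k] :
    CatModule.StabilityCategory (degree (k := k) (U := U)) where
  finite_hom := finite_hom
  mono := mono
  deg_le f := finrank_le f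
  exists_deg_eq := exists_degree_eq
  exists_initial := ⟨zero U, finrank_zero, fun _ => ⟨inferInstance⟩⟩
  extend := exists_extension
  hull := exists_hull

end VICU

theorem mainTheorem7 (k : Type u) [Field k] [Finite k] (R : Type v) [Field R] [CharZero R] :
    ((CatModule.presentedInFiniteDegree R (SI.degree (k := k))).IsClosedUnderKernels ∧
      (CatModule.presentedInFiniteDegree R (SI.degree (k := k))).IsClosedUnderCokernels ∧
      Nonempty (Abelian
        (CatModule.presentedInFiniteDegree R (SI.degree (k := k))).FullSubcategory)) ∧
    ∀ U : Subgroup kˣ,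
      (CatModule.presentedInFiniteDegree R (VICU.degree (k := k) (U := U))).IsClosedUnderKernels ∧
      (CatModule.presentedInFiniteDegree R
        (VICU.degree (k := k) (U := U))).IsClosedUnderCokernels ∧
      Nonempty (Abelian
        (CatModule.presentedInFiniteDegree R
          (VICU.degree (k := k) (U := U))).FullSubcategory) := by
  exact ⟨CatModule.abelian_presentedInFiniteDegree SI.stabilityCategory,
    fun _ => CatModule.abelian_presentedInFiniteDegree VICU.stabilityCategory⟩
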